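/- Let $G=\mathrm{Aff}_0(\mathbb R)=\{\begin{pmatrix}a&b\\0&1\end{pmatrix}: a>0,\ b\in\mathbb R\}$, with Lie algebra $\mathfrak g=\mathrm{aff}(\mathbb R)=\{Z=\begin{pmatrix}\alpha&\beta\\0&0\end{pmatrix}\}$, basis $X=\begin{pmatrix}1&0\\0&0\end{pmatrix}$, $Y=\begin{pmatrix}0&1\\0&0\end{pmatrix}$, and dual basis $X^*,Y^*$ of $\mathfrak g^*$. Let $\Omega_+$ be the coadjoint orbit of $Y^*$, with Darboux coordinates $(p,q)\mapsto pX^*+e^qY^*$, in which the Hamiltonian function of $Z$ is $\tilde Z=\alpha p+\beta e^q$. Let $u\star v=\sum_{r\ge0}\frac1{r!}\left(\frac1{2i}\right)^rP^r(u,v)$ be the Moyal product in these coordinates, where $P^0(u,v)=uv$, $P^r(u,v)=\Lambda^{i_1j_1}\cdots\Lambda^{i_rj_r}\,\partial_{i_1\cdots i_r}u\,\partial_{j_1\cdots j_r}v$ and $P^1(u,v)=\partial_pu\,\partial_qv-\partial_qu\,\partial_pv$. Let $\mathcal F_p$ be the unitary partial Fourier transform from $p$ to $x$ (kernel $\frac1{\sqrt{2\pi}}e^{-ipx}$)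 and put $\hat\ell_Zu=\mathcal F_p\big(i\tilde Z\star\mathcal F_p^{-1}u\big)$. Put $s=q-\frac x2$, $t=q+\frac x2$, $y=e^s>0$. **Theorem 4.2.** 1. $\Omega_+$ is the upper half-plane $\{F\in\mathfrak g^*:\langle F,Y\rangle>0\}$, and $\exp:\mathfrak g\to G$ is bijective. 2. The operator $\hat\ell_Z$ acts on the variable $y$ alone: for all $Z\in\mathfrak g$ and $f\in C_c^\infty(\mathbb R_{>0})$ there is a unique $h=:\hat\ell_Zf\in C_c^\infty(\mathbb R_{>0})$ such that, for every $\chi\in C_c^\infty(\mathbb R)$, the Moyal series defining $\hat\ell_Z[f(e^s)\chi(t)]$ converges at every point, its sum is integrable in $p$ for each $q$, and $\hat\ell_Z[f(e^s)\chi(t)]=h(e^s)\chi(t)$. 3. There is a strongly continuous unitary representation $T_{\Omega_+}$ of $G$ on $L^2(\mathbb R_{>0},\frac{dy}{y})$ with the following properties. * For every $Z\in\mathfrak g$, $t\mapsto T_{\Omega_+}(\exp tZ)$ is the exponential $\exp(t\hat\ell_Z)$, that is, it is the unique strongly continuous one-parameter group of bounded operators on $L^2(\mathbb R_{>0},\frac{dy}{y})$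 whose infinitesimal generator is the closure of $\hat\ell_Z$ (with domain $C_c^\infty(\mathbb R_{>0})$). * $T_{\Omega_+}$ is irreducible. * $T_{\Omega_+}$ is the representation attached to $\Omega_+$ by the orbit method: for every $F\in\Omega_+$, the subspace $\mathfrak h=\langle Y\rangle$ is a real polarization at $F$ satisfying the Pukanszky condition $F+\mathfrak h^\perp\subseteq\Omega_+$, it is the only one, and $T_{\Omega_+}$ is unitarily equivalent to $\mathrm{Ind}_H^G\chi_F$, where $H=\exp\langle Y\rangle$ and $\chi_F(\exp A)=e^{i\langle F,A\rangle}$ for $A\in\mathfrak h$. * For every $g=\begin{pmatrix}a&b\\0&1\end{pmatrix}\in G$ and $f\in L^2(\mathbb R_{>0},\frac{dy}{y})$, $(T_{\Omega_+}(g)f)(y)=e^{iby}f(ay)$ for almost every $y>0$. In particular $(\exp(\hat\ell_Z)f)(y)=e^{iby}f(ay)$ when $g=\exp Z$. -/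

import Mathlib

open MeasureTheory Filter Topology Set
open scoped ContDiff Matrix

attribute [local instance] LieRing.ofAssociativeRing

noncomputable section

/-! ## The group, its Lie algebra, the exponential map -/

/-- `Aff₀(ℝ)`: the matrices `!![a, b; 0, 1]` with `a > 0`. -/
def Aff0 : Subgroup (GL (Fin 2) ℝ) where
  carrier := {g | 0 < (g : Matrix (Fin 2) (Fin 2) ℝ) 0 0 ∧
    (g : Matrix (Fin 2) (Fin 2) ℝ) 1 0 = 0 ∧ (g : Matrix (Fin 2) (Fin 2) ℝ) 1 1 = 1}
  one_mem' := by simp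
  mul_mem' := by
    rintro g h ⟨g1, g2, g3⟩ ⟨h1, h2, h3⟩
    simp only [mem_ofPred_eq, Units.val_mul, Matrix.mul_apply, Fin.sum_univ_two, g2, g3, h2, h3]
    refine ⟨?_, ?_, ?_⟩
    · have := mul_pos g1 h1
      simpa using this
    · simp
    · simp
  inv_mem' := by
    rintro g ⟨g1, g2, g3⟩
    have h : (g : Matrix (Fin 2) (Fin 2) ℝ) * ((g⁻¹ : GL (Fin 2) ℝ) : Matrix (Fin 2) (Fin 2) ℝ)
        = 1 := by
      rw [← Units.val_mul]; simp
    have e00 := congrFun (congrFun h 0) 0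
    have e10 := congrFun (congrFun h 1) 0
    have e11 := congrFun (congrFun h 1) 1
    simp only [Matrix.mul_apply, Fin.sum_univ_two, g2, g3, zero_mul, one_mul, zero_add,
      Matrix.one_apply_eq, ne_eq, one_ne_zero, not_false_eq_true, Matrix.one_apply_ne]
      at e00 e10 e11
    rw [e10, mul_zero, add_zero] at e00
    refine ⟨?_, e10, e11⟩
    by_contra hc
    have := mul_nonpos_of_nonneg_of_nonpos g1.le (not_lt.mp hc)
    linarith

/-- The Borel structure of the matrix group. -/
instance : MeasurableSpace Aff0 := borel _

/-- The entries `a` and `b` of `g = !![a, b; 0, 1]`. -/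
def affA (g : Aff0) : ℝ := ((g : GL (Fin 2) ℝ) : Matrix (Fin 2) (Fin 2) ℝ) 0 0

def affB (g : Aff0) : ℝ := ((g : GL (Fin 2) ℝ) : Matrix (Fin 2) (Fin 2) ℝ) 0 1

/-- The Lie algebra `aff(ℝ)` of the matrices `!![α, β; 0, 0]`, with the commutator bracket. -/
def aff : LieSubalgebra ℝ (Matrix (Fin 2) (Fin 2) ℝ) where
  carrier := {Z | Z 1 0 = 0 ∧ Z 1 1 = 0}
  zero_mem' := by simp
  add_mem' := by
    rintro A B ⟨a1, a2⟩ ⟨b1, b2⟩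
    simp [a1, a2, b1, b2]
  smul_mem' := by
    rintro c A ⟨a1, a2⟩
    simp [a1, a2]
  lie_mem' := by
    rintro A B ⟨a1, a2⟩ ⟨b1, b2⟩
    simp [Ring.lie_def, Matrix.mul_apply, a1, a2, b1, b2]

def affX : aff := ⟨!![1, 0; 0, 0], by simp [aff]⟩

def affY : aff := ⟨!![0, 1; 0, 0], by simp [aff]⟩

theorem exp_row_one (Z : aff) :
    NormedSpace.exp (Z : Matrix (Fin 2) (Fin 2) ℝ) 1 0 = 0 ∧
    NormedSpace.exp (Z : Matrix (Fin 2) (Fin 2) ℝ) 1 1 = 1 := by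
  let _ : NormedRing (Matrix (Fin 2) (Fin 2) ℝ) := Matrix.linftyOpNormedRing
  let _ : NormedAlgebra ℝ (Matrix (Fin 2) (Fin 2) ℝ) := Matrix.linftyOpNormedAlgebra
  have hs := NormedSpace.exp_series_hasSum_exp' (𝕂 := ℝ) (Z : Matrix (Fin 2) (Fin 2) ℝ)
  have hpow : ∀ n : ℕ, ((Z : Matrix (Fin 2) (Fin 2) ℝ) ^ (n + 1)) 1 = 0 := by
    intro n
    funext j
    rw [pow_succ', Matrix.mul_apply, Fin.sum_univ_two, Z.2.1, Z.2.2]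
    simp
  have key : ∀ j, NormedSpace.exp (Z : Matrix (Fin 2) (Fin 2) ℝ) 1 j
      = (1 : Matrix (Fin 2) (Fin 2) ℝ) 1 j := by
    intro j
    have h1 := (Pi.hasSum.mp (Pi.hasSum.mp hs 1)) j
    have h2 := hasSum_single (f := fun n : ℕ =>
      (((n.factorial : ℝ)⁻¹) • (Z : Matrix (Fin 2) (Fin 2) ℝ) ^ n) 1 j) 0 (by
        intro n hn
        obtain ⟨m, rfl⟩ := Nat.exists_eq_succ_of_ne_zero hn
        rw [Matrix.smul_apply, Nat.succ_eq_add_one, hpow]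
        simp)
    have h3 := h1.unique h2
    refine h3.trans ?_
    simp only [Nat.factorial_zero, Nat.cast_one, inv_one, one_smul, pow_zero]
  exact ⟨by simpa using key 0, by simpa using key 1⟩

theorem exp_entry_pos (Z : aff) :
    0 < NormedSpace.exp (Z : Matrix (Fin 2) (Fin 2) ℝ) 0 0 := by
  have h2 := exp_row_one ((1 / 2 : ℝ) • Z)
  have hu := (Matrix.isUnit_exp (((1 / 2 : ℝ) • Z : aff) : Matrix (Fin 2) (Fin 2) ℝ))
  rw [Matrix.isUnit_iff_isUnit_det, Matrix.det_fin_two, h2.1, h2.2] at hu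
  have hsq : NormedSpace.exp (Z : Matrix (Fin 2) (Fin 2) ℝ)
      = NormedSpace.exp (((1 / 2 : ℝ) • Z : aff) : Matrix (Fin 2) (Fin 2) ℝ)
        * NormedSpace.exp (((1 / 2 : ℝ) • Z : aff) : Matrix (Fin 2) (Fin 2) ℝ) := by
    rw [← Matrix.exp_add_of_commute _ _ (Commute.refl _)]
    congr 1
    change (Z : Matrix (Fin 2) (Fin 2) ℝ) = (1 / 2 : ℝ) • (Z : Matrix (Fin 2) (Fin 2) ℝ)
      + (1 / 2 : ℝ) • (Z : Matrix (Fin 2) (Fin 2) ℝ)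
    rw [← add_smul]
    norm_num
  rw [hsq, Matrix.mul_apply, Fin.sum_univ_two, h2.1]
  have : NormedSpace.exp (((1 / 2 : ℝ) • Z : aff) : Matrix (Fin 2) (Fin 2) ℝ) 0 0 ≠ 0 := by
    intro h0
    rw [h0] at hu
    simp at hu
  have := mul_self_pos.mpr this
  simpa using this

/-- The exponential map `aff(ℝ) → Aff₀(ℝ)` (the matrix exponential). -/
def affExp (Z : aff) : Aff0 :=
  ⟨(Matrix.isUnit_exp (Z : Matrix (Fin 2) (Fin 2) ℝ)).unit,
    exp_entry_pos Z, (exp_row_one Z).1, (exp_row_one Z).2⟩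

/-! ## The coadjoint action -/

/-- `Ad(g) Z = g Z g⁻¹`. -/
def affAd (g : Aff0) : aff →ₗ[ℝ] aff where
  toFun Z := ⟨((g : GL (Fin 2) ℝ) : Matrix (Fin 2) (Fin 2) ℝ) * (Z : Matrix (Fin 2) (Fin 2) ℝ) *
      (((g⁻¹ : Aff0) : GL (Fin 2) ℝ) : Matrix (Fin 2) (Fin 2) ℝ), by
    obtain ⟨-, g2, g3⟩ := g.2
    obtain ⟨z1, z2⟩ := Z.2
    constructor <;>
      simp only [Matrix.mul_apply, Fin.sum_univ_two, g2, g3, z1, z2, mul_zero, zero_mul, add_zero]⟩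
  map_add' A B := by
    ext1
    simp [mul_add, add_mul]
  map_smul' c A := by
    ext1
    simp

/-- `⟨K(g)F, Z⟩ = ⟨F, Ad(g⁻¹) Z⟩`. -/
def coadjoint (g : Aff0) (F : Module.Dual ℝ aff) : Module.Dual ℝ aff := F ∘ₗ affAd g⁻¹

def coadjointOrbit (F : Module.Dual ℝ aff) : Set (Module.Dual ℝ aff) :=
  range fun g : Aff0 => coadjoint g F

/-- The basis `X*, Y*` of the dual that is dual to `X, Y`. -/
def affXstar : Module.Dual ℝ aff where
  toFun Z := (Z : Matrix (Fin 2) (Fin 2) ℝ) 0 0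
  map_add' A B := by simp
  map_smul' c A := by simp

def affYstar : Module.Dual ℝ aff where
  toFun Z := (Z : Matrix (Fin 2) (Fin 2) ℝ) 0 1
  map_add' A B := by simp
  map_smul' c A := by simp

/-- The orbit `Ω₊`, i.e. the coadjoint orbit of `Y*`. -/
def OmegaPlus : Set (Module.Dual ℝ aff) := coadjointOrbit affYstar

/-! ## The Moyal product in the Darboux coordinates `(p, q)` of `Ω₊` -/

/-- The coordinates `(p, q) ↦ p X* + e^q Y*`. -/
def darboux (z : ℝ × ℝ) : Module.Dual ℝ aff := z.1 • affXstar + Real.exp z.2 • affYstar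

/-- The Hamiltonian function `Z̃(F) = ⟨F, Z⟩` in the coordinates `(p, q)`. -/
def hamiltonian (Z : aff) (z : ℝ × ℝ) : ℂ := ((darboux z Z : ℝ) : ℂ)

/-- `∂_p` (index `0`) and `∂_q` (index `1`). -/
def pderiv2 (i : Fin 2) (u : ℝ × ℝ → ℂ) (z : ℝ × ℝ) : ℂ :=
  if i = 0 then deriv (fun p : ℝ => u (p, z.2)) z.1 else deriv (fun q : ℝ => u (z.1, q)) z.2

/-- `∂_{i₁ … i_r}`. -/
def mderiv {r : ℕ} (I : Fin r → Fin 2) (u : ℝ × ℝ → ℂ) : ℝ × ℝ → ℂ :=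
  (List.ofFn I).foldr pderiv2 u

/-- The Poisson tensor of `dp ∧ dq`, normalized so that
`{u, v} = ∂_p u ∂_q v - ∂_q u ∂_p v`. -/
def poissonTensor : Matrix (Fin 2) (Fin 2) ℂ := !![0, 1; -1, 0]

/-- `P^r(u, v) = Λ^{i₁j₁} ⋯ Λ^{i_r j_r} ∂_{i₁…i_r} u ∂_{j₁…j_r} v`; `P^0(u, v) = u v`. -/
def bidiff (r : ℕ) (u v : ℝ × ℝ → ℂ) (z : ℝ × ℝ) : ℂ :=
  ∑ I : Fin r → Fin 2, ∑ J : Fin r → Fin 2,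
    (∏ k, poissonTensor (I k) (J k)) * mderiv I u z * mderiv J v z

/-- `w = u ⋆ v = ∑_{r ≥ 0} (1/r!) (1/(2i))^r P^r(u, v)`, the series converging at every point. -/
def IsMoyalProduct (u v w : ℝ × ℝ → ℂ) : Prop :=
  ∀ z, HasSum (fun r : ℕ =>
    (1 / (r.factorial : ℂ)) * (1 / (2 * Complex.I)) ^ r * bidiff r u v z) (w z)

/-- The partial Fourier transform from the variable `p` to the variable `x`. -/
def partialFourier (u : ℝ × ℝ → ℂ) (z : ℝ × ℝ) : ℂ :=
  (1 / (Real.sqrt (2 * Real.pi) : ℂ)) *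
    ∫ p : ℝ, Complex.exp (-Complex.I * p * z.1) * u (p, z.2)

/-- Its inverse, from the variable `x` to the variable `p`. -/
def partialFourierInv (u : ℝ × ℝ → ℂ) (z : ℝ × ℝ) : ℂ :=
  (1 / (Real.sqrt (2 * Real.pi) : ℂ)) *
    ∫ x : ℝ, Complex.exp (Complex.I * z.1 * x) * u (x, z.2)

/-- `w = ℓ̂_Z u = F_p (i Z̃ ⋆ F_p⁻¹ u)`: the Moyal series converges and the Fourier integral of
its sum converges absolutely. -/
def IsEllHat (Z : aff) (u w : ℝ × ℝ → ℂ) : Prop :=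
  ∃ v : ℝ × ℝ → ℂ,
    IsMoyalProduct (fun z => Complex.I * hamiltonian Z z) (partialFourierInv u) v ∧
    (∀ q : ℝ, Integrable fun p : ℝ => v (p, q)) ∧
    w = partialFourier v

/-! ## The operator `ℓ̂_Z` as an operator in the variable `y = e^s`, `s = q - x/2` -/

/-- `f ∈ C_c^∞(ℝ)`. -/
def IsTestFun (f : ℝ → ℂ) : Prop := ContDiff ℝ ∞ f ∧ HasCompactSupport f

/-- `f ∈ C_c^∞(ℝ_{>0})`, extended by zero to `ℝ`. -/
def IsHalfLineTestFun (f : ℝ → ℂ) : Prop := IsTestFun f ∧ tsupport f ⊆ Ioi 0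

/-- The function `f(e^s) χ(t)` of `(x, q)`, where `s = q - x/2` and `t = q + x/2`. -/
def liftST (f χ : ℝ → ℂ) (z : ℝ × ℝ) : ℂ :=
  f (Real.exp (z.2 - z.1 / 2)) * χ (z.2 + z.1 / 2)

/-- `h = ℓ̂_Z f` for functions of the single variable `y = e^s`: the operator `ℓ̂_Z` of two
variables maps `f(e^s) χ(t)` to `h(e^s) χ(t)`, for every test function `χ` of the inert
variable `t`. -/
def IsEllHatHalfLine (Z : aff) (f h : ℝ → ℂ) : Prop :=
  ∀ χ : ℝ → ℂ, IsTestFun χ → IsEllHat Z (liftST f χ) (liftST h χ)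

/-- The measure `dy / y` on `ℝ_{>0}`. -/
def halfLineMeasure : Measure ℝ :=
  (volume.restrict (Ioi 0)).withDensity fun y => ENNReal.ofReal y⁻¹

/-- `L²(ℝ_{>0}, dy / y)`. -/
abbrev L2HalfLine : Type := Lp ℂ 2 halfLineMeasure

/-- The graph of `ℓ̂_Z`, as an operator in `L²(ℝ_{>0}, dy/y)` with domain `C_c^∞(ℝ_{>0})`. -/
def ellHatGraph (Z : aff) : Set (L2HalfLine × L2HalfLine) :=
  {w | ∃ f h : ℝ → ℂ, IsHalfLineTestFun f ∧ IsHalfLineTestFun h ∧ IsEllHatHalfLine Z f h ∧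
    w.1 =ᵐ[halfLineMeasure] f ∧ w.2 =ᵐ[halfLineMeasure] h}

/-! ## Exponentials of unbounded operators, unitary representations -/

section General

variable {E : Type*} [NormedAddCommGroup E] [InnerProductSpace ℂ E]

/-- `U t = exp(t A)`, `t ∈ ℝ`, for an operator `A` given by its graph: `U` is a strongly
continuous one-parameter group of bounded operators and its infinitesimal generator is the
closure of `A`. -/
structure IsExpGroup (A : Set (E × E)) (U : ℝ → E →L[ℂ] E) : Prop where
  zero : U 0 = 1
  add : ∀ s t, U (s + t) = U s * U t
  cont : ∀ φ, Continuous fun t => U t φ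
  generator : {w : E × E | Tendsto (fun t : ℝ => (t : ℂ)⁻¹ • (U t w.1 - w.1))
    (𝓝[≠] 0) (𝓝 w.2)} = closure A

variable [CompleteSpace E] {Γ : Type*} [Group Γ]

/-- No closed invariant subspaces except `0` and the whole (nonzero) space. -/
def IsIrreducibleRep (T : Γ →* unitary (E →L[ℂ] E)) : Prop :=
  Nontrivial E ∧ ∀ V : Submodule ℂ E, IsClosed (V : Set E) →
    (∀ g, ∀ φ ∈ V, (T g : E →L[ℂ] E) φ ∈ V) → V = ⊥ ∨ V = ⊤

/-- The space `H \ Γ` of cosets `H g`. -/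
abbrev RightCosets (H : Subgroup Γ) : Type _ := Quotient (QuotientGroup.rightRel H)

/-- `H x ↦ H x g`. -/
def cosetMul (H : Subgroup Γ) (g : Γ) : RightCosets H → RightCosets H :=
  Quotient.map (fun x => x * g) (by
    intro x y h
    have h' := QuotientGroup.rightRel_apply.mp h
    exact QuotientGroup.rightRel_apply.mpr (by simpa [mul_assoc] using h'))

/-- `T` is (unitarily equivalent to) the unitary representation `Ind_H^Γ χ` induced by the unitary
character `χ` of the closed subgroup `H`: the representation in `L²(H \ Γ, μ)`,
`(T(g) φ)(x) = χ(h) (dμ(x g)/dμ(x))^{1/2} φ(x g)`, where `s(x) g = h s(x g)` with `h ∈ H`,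
for a nonzero σ-finite quasi-invariant measure `μ` on `H \ Γ` and a Borel section `s` of
`Γ → H \ Γ`. -/
def IsInducedRep [MeasurableSpace Γ] {H : Subgroup Γ} (χ : H →* Circle)
    (T : Γ →* unitary (E →L[ℂ] E)) : Prop :=
  ∃ (μ : Measure (RightCosets H)) (s : RightCosets H → Γ) (W : E ≃ₗᵢ[ℂ] Lp ℂ 2 μ),
    SigmaFinite μ ∧ μ ≠ 0 ∧ (∀ g, μ.map (cosetMul H g) ≪ μ) ∧
    Measurable s ∧ (∀ x, (Quotient.mk _ (s x) : RightCosets H) = x) ∧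
    ∀ (g : Γ) (φ : E), ∀ᵐ x ∂μ, ∀ h : H, s x * g = h * s (cosetMul H g x) →
      W ((T g : E →L[ℂ] E) φ) x =
        (χ h : ℂ) * (Real.sqrt ((μ.map (cosetMul H g⁻¹)).rnDeriv μ x).toReal : ℂ) *
          W φ (cosetMul H g x)

end General

/-! ## The orbit method -/

/-- `𝔥` is a real polarization at `F` satisfying the Pukanszky condition: a subalgebra that is a
maximal isotropic subspace for `(A, B) ↦ ⟨F, [A, B]⟩`, with `F + 𝔥^⊥` contained in the orbit
of `F`. -/
structure IsAdmissible (F : Module.Dual ℝ aff) (𝔥 : LieSubalgebra ℝ aff) : Prop where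
  isotropic : ∀ A ∈ 𝔥, ∀ B ∈ 𝔥, F ⁅A, B⁆ = 0
  maximal : ∀ V : Submodule ℝ aff, 𝔥.toSubmodule ≤ V →
    (∀ A ∈ V, ∀ B ∈ V, F ⁅A, B⁆ = 0) → V = 𝔥.toSubmodule
  pukanszky : ∀ F' : Module.Dual ℝ aff, (∀ A ∈ 𝔥, F' A = F A) → F' ∈ coadjointOrbit F

/-- The analytic subgroup with Lie algebra `𝔥`, generated by `exp 𝔥`. -/
def analyticSubgroup (𝔥 : LieSubalgebra ℝ aff) : Subgroup Aff0 :=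
  Subgroup.closure (affExp '' (𝔥 : Set aff))

/-- `T` is the representation attached to the orbit `Ω` by the orbit method: for every `F ∈ Ω`
there are admissible `𝔥`, and for each of them `T` is equivalent to `Ind_H^G χ_F`, where `H` is the
analytic subgroup of `𝔥` and `χ_F(exp A) = e^{i⟨F, A⟩}` for `A ∈ 𝔥`. -/
def IsOrbitMethodRep {E : Type*} [NormedAddCommGroup E] [InnerProductSpace ℂ E] [CompleteSpace E]
    (Ω : Set (Module.Dual ℝ aff)) (T : Aff0 →* unitary (E →L[ℂ] E)) : Prop :=
  ∀ F ∈ Ω, (∃ 𝔥, IsAdmissible F 𝔥) ∧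
    ∀ 𝔥, IsAdmissible F 𝔥 → ∃ χ : analyticSubgroup 𝔥 →* Circle,
      (∀ A ∈ 𝔥, ∀ h : analyticSubgroup 𝔥, (h : Aff0) = affExp A →
        (χ h : ℂ) = Complex.exp (Complex.I * (F A : ℝ))) ∧
      IsInducedRep χ T

end

/-!
The coadjoint orbit of `Y*` is the half-plane `⟨F, Y⟩ > 0`, because `Ad(g⁻¹) Y = a⁻¹ Y`. The
powers of `Z = α X + β Y` are `Z ^ (n + 1) = α ^ n Z`, so `exp Z = 1 + ((e^α - 1) / α) Z`
(`exp_aff`), which is visibly a bijection onto the group.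

The function `i Z̃ = i (α p + β e^q)` is affine in `p`, hence `α` enters only the terms of order
`r ≤ 1` of the Moyal product with `v = F_p⁻¹ u`, and the part of the `r`-th term with `β` is
`i β e^q (i/2)^r ∂_p^r v / r!` (`bidiff_iHam_add_two`). On the Fourier side `∂_p` is
multiplication by `i x`, so that these parts sum to multiplication by `i β e^q e^{-x/2}`
(`hasSum_partialFourierInv`), and `ℓ̂_Z = -α ∂_x + (α/2) ∂_q + i β e^{q - x/2}`
(`isEllHat_ellXQ`). In the coordinates `s, t` this is `α ∂_s + i β e^s` (`ellXQ_liftST`), i.e.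
`α y ∂_y + i β y` in the variable `y = e^s`.

The representation is `T(g) f(y) = e^{iby} f(ay)` (`affRep`), unitary since `dy/y` is
invariant under dilations. Its derivative along `exp tZ` is `α y ∂_y + i β y` on test functions
(`ellGraph_subset_generatorGraph`). The test functions are dense and invariant under the flow, hence
a core of the generator (`generatorGraph_eq_closure`), and a generator that is skew-symmetric
determines its group (`eq_of_generatorGraph_eq`).

For irreducibility, let `φ` lie in a closed invariant subspace and `ψ` in its orthogonal
complement. The coefficient `⟪ψ, T(a, b) φ⟫` is, as a function of `b`, the Fourier transform of
`y ↦ φ(ay) conj(ψ y)` for `dy/y`. Its vanishing gives `φ(ay) ψ(y) = 0` for almost all `y`, for each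
`a`, and integration over `a` and `y` gives `φ = 0` or `ψ = 0`
(`eq_zero_or_eq_zero_of_inner_eq_zero`).

A subalgebra that satisfies the Pukanszky condition contains `Y`, since otherwise some functional
that agrees with `F` on it vanishes at `Y`; isotropy then forces it to be `⟨Y⟩`
(`isAdmissible_iff`). The space `H \ G` is `ℝ_{>0}` with coordinate `a` and invariant measure
`da/a`, and the substitution `y = ⟨F, Y⟩ a` identifies the induced representation with `T`
(`isInducedRep_affRep`).
-/

noncomputable section

/-! ### The group and the coadjoint orbit -/

theorem affA_pos (g : Aff0) : 0 < affA g := g.2.1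

theorem Aff0.ext_entries {g h : Aff0} (hA : affA g = affA h) (hB : affB g = affB h) : g = h := by
  apply Subtype.ext
  apply Units.ext
  ext i j
  fin_cases i <;> fin_cases j
  · exact hA
  · exact hB
  · exact g.2.2.1.trans h.2.2.1.symm
  · exact g.2.2.2.trans h.2.2.2.symm

@[simp] theorem affA_one : affA 1 = 1 := by simp [affA]

@[simp] theorem affB_one : affB 1 = 0 := by simp [affB]

@[simp] theorem affA_mul (g h : Aff0) : affA (g * h) = affA g * affA h := by
  have := h.2.2.1
  simp [affA, Matrix.mul_apply, this]

@[simp] theorem affB_mul (g h : Aff0) : affB (g * h) = affA g * affB h + affB g := by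
  have := h.2.2.2
  simp [affA, affB, Matrix.mul_apply, this]

@[simp] theorem affA_inv (g : Aff0) : affA g⁻¹ = (affA g)⁻¹ := by
  have h : affA (g⁻¹ * g) = 1 := by rw [inv_mul_cancel, affA_one]
  rw [affA_mul] at h
  exact eq_inv_of_mul_eq_one_left h

/-- The element `!![a, b; 0, 1]` of `Aff₀(ℝ)`. -/
def Aff0.mk (a b : ℝ) (ha : 0 < a) : Aff0 :=
  ⟨⟨!![a, b; 0, 1], !![a⁻¹, -(a⁻¹ * b); 0, 1],
    by ext i j; fin_cases i <;> fin_cases j <;> simp [ha.ne'],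
    by ext i j; fin_cases i <;> fin_cases j <;> simp [ha.ne']⟩, by simp [ha], by simp, by simp⟩

@[simp] theorem affA_mk (a b : ℝ) (ha : 0 < a) : affA (Aff0.mk a b ha) = a := rfl

@[simp] theorem affB_mk (a b : ℝ) (ha : 0 < a) : affB (Aff0.mk a b ha) = b := rfl

theorem aff_ext {Z W : aff} (h0 : Z.1 0 0 = W.1 0 0) (h1 : Z.1 0 1 = W.1 0 1) : Z = W := by
  apply Subtype.ext
  ext i j
  fin_cases i <;> fin_cases j
  · exact h0
  · exact h1
  · exact Z.2.1.trans W.2.1.symm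
  · exact Z.2.2.trans W.2.2.symm

theorem aff_eq_smul_add_smul (Z : aff) : Z = Z.1 0 0 • affX + Z.1 0 1 • affY := by
  apply aff_ext <;> simp [affX, affY]

theorem dual_aff_apply (F : Module.Dual ℝ aff) (Z : aff) :
    F Z = Z.1 0 0 * F affX + Z.1 0 1 * F affY := by
  conv_lhs => rw [aff_eq_smul_add_smul Z]
  simp

theorem coadjoint_affYstar_apply (g : Aff0) (Z : aff) :
    coadjoint g affYstar Z = (affA g)⁻¹ * (Z.1 0 0 * affB g + Z.1 0 1) := by
  have hi := affA_inv g
  have hz := Z.2.1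
  have hz' := Z.2.2
  have hg := g.2.2.2
  have hB : (g.1 : Matrix (Fin 2) (Fin 2) ℝ) 0 1 = affB g := rfl
  have hj : ((g⁻¹ : Aff0).1 : Matrix (Fin 2) (Fin 2) ℝ) 0 0 = (affA g)⁻¹ := hi
  change (((g⁻¹ : Aff0).1 : Matrix (Fin 2) (Fin 2) ℝ) * Z.1 *
    (((g⁻¹)⁻¹ : Aff0).1 : Matrix (Fin 2) (Fin 2) ℝ)) 0 1 = _
  simp only [Matrix.mul_apply, Fin.sum_univ_two, hz, hz', inv_inv, hg, hB, hj]
  ring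

/-- The coadjoint orbit of `Y*` is the open upper half-plane. -/
theorem omegaPlus_eq : OmegaPlus = {F : Module.Dual ℝ aff | 0 < F affY} := by
  ext F
  constructor
  · rintro ⟨g, rfl⟩
    simp only [mem_ofPred_eq, coadjoint_affYstar_apply]
    simpa [affY] using affA_pos g
  · intro hF
    have hF : 0 < F affY := hF
    refine ⟨Aff0.mk (F affY)⁻¹ (F affX / F affY) (inv_pos.mpr hF), ?_⟩
    ext Z
    simp only [coadjoint_affYstar_apply, affA_mk, affB_mk, inv_inv]
    rw [dual_aff_apply F Z]
    field_simp

theorem coadjoint_mul (g h : Aff0) (F : Module.Dual ℝ aff) :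
    coadjoint (g * h) F = coadjoint g (coadjoint h F) := by
  ext Z
  simp only [coadjoint, LinearMap.comp_apply]
  congr 1
  apply Subtype.ext
  simp [affAd, mul_assoc]

theorem coadjointOrbit_eq_omegaPlus {F : Module.Dual ℝ aff} (hF : F ∈ OmegaPlus) :
    coadjointOrbit F = OmegaPlus := by
  obtain ⟨g, rfl⟩ := hF
  ext F'
  constructor
  · rintro ⟨h, rfl⟩
    exact ⟨h * g, coadjoint_mul _ _ _⟩
  · rintro ⟨h, rfl⟩
    refine ⟨h * g⁻¹, ?_⟩
    simp only [← coadjoint_mul, inv_mul_cancel_right]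

/-! ### The exponential map -/

/-- The function `α ↦ (e^α - 1) / α`, continued by `1` at `α = 0`. -/
def expQuot (α : ℝ) : ℝ := if α = 0 then 1 else (Real.exp α - 1) / α

theorem mul_expQuot (α : ℝ) : α * expQuot α = Real.exp α - 1 := by
  unfold expQuot
  split_ifs with h
  · simp [h]
  · field_simp

theorem expQuot_ne_zero (α : ℝ) : expQuot α ≠ 0 := by
  unfold expQuot
  split_ifs with h
  · simp
  · have : Real.exp α ≠ 1 := by simpa using h
    exact div_ne_zero (sub_ne_zero.mpr this) h

theorem hasDerivAt_mul_expQuot (α t : ℝ) :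
    HasDerivAt (fun t : ℝ => t * expQuot (t * α)) (Real.exp (t * α)) t := by
  by_cases h : α = 0
  · subst h
    simpa [expQuot] using hasDerivAt_id' t
  · have e : (fun t : ℝ => t * expQuot (t * α)) = fun t => (Real.exp (t * α) - 1) / α := by
      funext t
      rw [← mul_expQuot]
      field_simp
    rw [e]
    have := (((hasDerivAt_id t).mul_const α).exp.sub_const 1).div_const α
    simpa [h] using this

/-- `Z ^ (n + 1) = α ^ n Z` makes the exponential series of `Z` scalar. -/
theorem exp_aff (Z : aff) :
    NormedSpace.exp (Z : Matrix (Fin 2) (Fin 2) ℝ) = 1 + expQuot (Z.1 0 0) • Z.1 := by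
  let _ : NormedRing (Matrix (Fin 2) (Fin 2) ℝ) := Matrix.linftyOpNormedRing
  let _ : NormedAlgebra ℝ (Matrix (Fin 2) (Fin 2) ℝ) := Matrix.linftyOpNormedAlgebra
  set α := Z.1 0 0 with hα
  have hsq : Z.1 * Z.1 = α • Z.1 := by
    ext i j
    fin_cases i <;> fin_cases j <;> simp [Matrix.mul_apply, Z.2.1, Z.2.2, hα]
  have hpow : ∀ n : ℕ, Z.1 ^ (n + 1) = α ^ n • Z.1 := by
    intro n
    induction n with
    | zero => simp
    | succ n ih => rw [pow_succ, ih, smul_mul_assoc, hsq, smul_smul, pow_succ]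
  have hs := NormedSpace.exp_series_hasSum_exp' (𝕂 := ℝ) (Z : Matrix (Fin 2) (Fin 2) ℝ)
  have hs1 := (hasSum_nat_add_iff' 1).mpr hs
  simp only [hpow, Finset.range_one, Finset.sum_singleton, Nat.factorial_zero, Nat.cast_one,
    inv_one, pow_zero, one_smul] at hs1
  have he : HasSum (fun n : ℕ => ((n + 1).factorial : ℝ)⁻¹ * α ^ n) (expQuot α) := by
    by_cases h : α = 0
    · rw [h]
      have := hasSum_single (f := fun n : ℕ => ((n + 1).factorial : ℝ)⁻¹ * (0 : ℝ) ^ n) 0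
        (by intro n hn; simp [hn])
      simpa [expQuot] using this
    · have h1 := (hasSum_nat_add_iff' 1).mpr (NormedSpace.exp_series_hasSum_exp' (𝕂 := ℝ) α)
      rw [← Real.exp_eq_exp_ℝ] at h1
      have h2 := h1.div_const α
      simp only [Finset.range_one, Finset.sum_singleton, Nat.factorial_zero, Nat.cast_one,
        inv_one, pow_zero, one_smul] at h2
      rw [expQuot, if_neg h]
      refine h2.congr_fun fun n => ?_
      rw [smul_eq_mul, pow_succ]
      field_simp
  have hs2 := he.smul_const Z.1
  simp only [smul_smul] at hs1
  rw [← hs1.unique hs2]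
  abel

@[simp] theorem affA_affExp (Z : aff) : affA (affExp Z) = Real.exp (Z.1 0 0) := by
  have : affA (affExp Z) = NormedSpace.exp (Z : Matrix (Fin 2) (Fin 2) ℝ) 0 0 := rfl
  rw [this, exp_aff, Matrix.add_apply, Matrix.smul_apply, smul_eq_mul, mul_comm, mul_expQuot]
  simp

@[simp] theorem affB_affExp (Z : aff) : affB (affExp Z) = expQuot (Z.1 0 0) * Z.1 0 1 := by
  have : affB (affExp Z) = NormedSpace.exp (Z : Matrix (Fin 2) (Fin 2) ℝ) 0 1 := rfl
  rw [this, exp_aff]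
  simp

theorem affExp_bijective : Function.Bijective affExp := by
  constructor
  · intro Z W h
    have hA := congrArg affA h
    have hB := congrArg affB h
    simp only [affA_affExp, affB_affExp, Real.exp_eq_exp] at hA hB
    rw [hA] at hB
    exact aff_ext hA (mul_left_cancel₀ (expQuot_ne_zero _) hB)
  · intro g
    refine ⟨Real.log (affA g) • affX + (affB g / expQuot (Real.log (affA g))) • affY, ?_⟩
    apply Aff0.ext_entries
    · simp [affX, affY, Real.exp_log (affA_pos g)]
    · simp [affX, affY, mul_div_cancel₀ _ (expQuot_ne_zero _)]

theorem aff_coe_smul (t : ℝ) (Z : aff) : (t • Z).1 = t • Z.1 := rfl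

theorem affA_affExp_smul (Z : aff) (t : ℝ) :
    affA (affExp (t • Z)) = Real.exp (t * Z.1 0 0) := by
  simp

theorem affB_affExp_smul (Z : aff) (t : ℝ) :
    affB (affExp (t • Z)) = Z.1 0 1 * (t * expQuot (t * Z.1 0 0)) := by
  simp only [affB_affExp, aff_coe_smul, Matrix.smul_apply, smul_eq_mul]
  ring

theorem affExp_add_smul (Z : aff) (s t : ℝ) :
    affExp ((s + t) • Z) = affExp (s • Z) * affExp (t • Z) := by
  apply Subtype.ext
  apply Units.ext
  change NormedSpace.exp ((s + t) • Z.1) = NormedSpace.exp (s • Z.1) * NormedSpace.exp (t • Z.1)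
  rw [add_smul]
  exact Matrix.exp_add_of_commute _ _ (((Commute.refl Z.1).smul_left s).smul_right t)

/-! ### Polarizations -/

theorem lie_affY (A : aff) : ⁅A, affY⁆ = A.1 0 0 • affY := by
  apply aff_ext <;> simp [affY, LieSubalgebra.coe_bracket, Ring.lie_def, Matrix.mul_apply,
    Matrix.vecMul, dotProduct, A.2.1, A.2.2]

theorem mem_span_affY {A : aff} : A ∈ Submodule.span ℝ {affY} ↔ A.1 0 0 = 0 := by
  rw [Submodule.mem_span_singleton]
  constructor
  · rintro ⟨c, rfl⟩
    simp [affY]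
  · intro h
    exact ⟨A.1 0 1, aff_ext (by simp [affY, h]) (by simp [affY])⟩

/-- `⟨Y⟩` is the only polarization satisfying the Pukanszky condition: a polarization that omits `Y`
has affine spaces `F + 𝔥^⊥` that leave the half-plane. -/
theorem isAdmissible_iff {F : Module.Dual ℝ aff} (hF : F ∈ OmegaPlus)
    (𝔥 : LieSubalgebra ℝ aff) :
    IsAdmissible F 𝔥 ↔ 𝔥.toSubmodule = Submodule.span ℝ {affY} := by
  have hpos : 0 < F affY := by rw [omegaPlus_eq] at hF; exact hF
  have iso : ∀ V : Submodule ℝ aff, affY ∈ V → (∀ A ∈ V, ∀ B ∈ V, F ⁅A, B⁆ = 0) →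
      V ≤ Submodule.span ℝ {affY} := by
    intro V hY hV A hA
    have := hV A hA affY hY
    rw [lie_affY, map_smul, smul_eq_mul] at this
    exact mem_span_affY.mpr ((mul_eq_zero.mp this).resolve_right hpos.ne')
  constructor
  · rintro ⟨h1, h2, h3⟩
    have hY : affY ∈ 𝔥.toSubmodule := by
      by_contra hY
      obtain ⟨ξ, hξ, hξ'⟩ := Submodule.exists_le_ker_of_notMem hY
      have := h3 (F - (F affY / ξ affY) • ξ) (by
        intro A hA
        have : ξ A = 0 := hξ' hA
        simp [this])
      rw [coadjointOrbit_eq_omegaPlus hF, omegaPlus_eq] at this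
      simp [hξ] at this
    refine le_antisymm (iso _ hY h1) ?_
    rw [Submodule.span_singleton_le_iff_mem]
    exact hY
  · intro h
    have hmem : ∀ A, A ∈ 𝔥 ↔ A.1 0 0 = 0 := by
      intro A
      rw [← mem_span_affY, ← h]
      rfl
    refine ⟨?_, ?_, ?_⟩
    · intro A hA B hB
      have : ⁅A, B⁆ = 0 := by
        rw [hmem] at hA hB
        apply aff_ext <;> simp [LieSubalgebra.coe_bracket, Ring.lie_def, Matrix.mul_apply,
          A.2.1, B.2.1, A.2.2, B.2.2, hA, hB]
      rw [this, map_zero]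
    · intro V hV hV'
      refine le_antisymm ?_ hV
      rw [h]
      refine iso V (hV ?_) hV'
      rw [h]
      exact Submodule.mem_span_singleton_self _
    · intro F' hF'
      rw [coadjointOrbit_eq_omegaPlus hF, omegaPlus_eq]
      have : affY ∈ 𝔥 := by rw [hmem]; simp [affY]
      simpa [hF' affY this] using hpos

theorem exists_isAdmissible {F : Module.Dual ℝ aff} (hF : F ∈ OmegaPlus) :
    ∃ 𝔥, IsAdmissible F 𝔥 := by
  refine ⟨{ Submodule.span ℝ {affY} with lie_mem' := ?_ }, (isAdmissible_iff hF _).mpr rfl⟩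
  intro A B _ _
  change ⁅A, B⁆ ∈ Submodule.span ℝ {affY}
  rw [mem_span_affY]
  simp [LieSubalgebra.coe_bracket, Ring.lie_def, Matrix.mul_apply, A.2.1, B.2.1, mul_comm]

theorem mem_analyticSubgroup {𝔥 : LieSubalgebra ℝ aff}
    (h : 𝔥.toSubmodule = Submodule.span ℝ {affY}) (g : Aff0) :
    g ∈ analyticSubgroup 𝔥 ↔ affA g = 1 := by
  have hmem : ∀ A, A ∈ 𝔥 ↔ A.1 0 0 = 0 := by
    intro A
    rw [← mem_span_affY, ← h]
    rfl
  constructor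
  · intro hg
    induction hg using Subgroup.closure_induction with
    | mem x hx =>
      obtain ⟨A, hA, rfl⟩ := hx
      rw [affA_affExp, (hmem A).mp hA, Real.exp_zero]
    | one => exact affA_one
    | mul x y _ _ hx hy => rw [affA_mul, hx, hy, one_mul]
    | inv x _ hx => rw [affA_inv, hx, inv_one]
  · intro hg
    obtain ⟨A, rfl⟩ := affExp_bijective.2 g
    rw [affA_affExp, Real.exp_eq_one_iff] at hg
    exact Subgroup.subset_closure ⟨A, (hmem A).mpr hg, rfl⟩

/-! ### The measure `dy / y` -/

theorem measurePreserving_exp : MeasurePreserving Real.exp volume halfLineMeasure := by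
  refine ⟨Real.measurable_exp, ?_⟩
  ext s hs
  have himg : s ∩ Ioi 0 = Real.exp '' (Real.exp ⁻¹' s) := by
    rw [image_preimage_eq_inter_range, Real.range_exp]
  rw [Measure.map_apply Real.measurable_exp hs, halfLineMeasure, withDensity_apply _ hs,
    Measure.restrict_restrict hs, himg,
    lintegral_image_eq_lintegral_abs_deriv_mul (Real.measurable_exp hs)
      (fun x _ => (Real.hasDerivAt_exp x).hasDerivWithinAt) Real.exp_injective.injOn]
  have : ∀ x : ℝ, ENNReal.ofReal |Real.exp x| * ENNReal.ofReal (Real.exp x)⁻¹ = 1 := by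
    intro x
    rw [← ENNReal.ofReal_mul (abs_nonneg _), abs_of_pos (Real.exp_pos x),
      mul_inv_cancel₀ (Real.exp_pos x).ne', ENNReal.ofReal_one]
  simp only [this, lintegral_const, Measure.restrict_apply_univ, one_mul]

instance : SigmaFinite halfLineMeasure :=
  SigmaFinite.withDensity_ofReal _

theorem ae_pos_halfLineMeasure : ∀ᵐ y ∂halfLineMeasure, 0 < y :=
  (withDensity_absolutelyContinuous _ _).ae_le (ae_restrict_mem measurableSet_Ioi)

theorem measurePreserving_mul_left {a : ℝ} (ha : 0 < a) :
    MeasurePreserving (fun y => a * y) halfLineMeasure halfLineMeasure := by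
  refine ⟨measurable_const_mul a, ?_⟩
  have h1 := measurePreserving_exp.comp (measurePreserving_add_left volume (Real.log a))
  have h2 : Real.exp ∘ (fun x => Real.log a + x) = (fun y => a * y) ∘ Real.exp := by
    funext x
    simp [Real.exp_add, Real.exp_log ha]
  rw [h2] at h1
  conv_lhs => rw [← measurePreserving_exp.map_eq]
  rw [Measure.map_map (measurable_const_mul a) Real.measurable_exp, h1.map_eq]

theorem halfLineMeasure_Icc_lt_top {a b : ℝ} (ha : 0 < a) : halfLineMeasure (Icc a b) < ⊤ := by
  rw [← measurePreserving_exp.map_eq, Measure.map_apply Real.measurable_exp measurableSet_Icc]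
  refine lt_of_le_of_lt (measure_mono (t := Icc (Real.log a) (Real.log b)) ?_)
    measure_Icc_lt_top
  intro x hx
  have h1 := Real.log_le_log ha hx.1
  have h2 := Real.log_le_log (Real.exp_pos x) hx.2
  rw [Real.log_exp] at h1 h2
  exact ⟨h1, h2⟩

theorem exists_subset_Icc_of_isCompact {K : Set ℝ} (hK : IsCompact K) (hK' : K ⊆ Ioi 0) :
    ∃ a b : ℝ, 0 < a ∧ K ⊆ Icc a b := by
  rcases K.eq_empty_or_nonempty with rfl | hne
  · exact ⟨1, 1, one_pos, empty_subset _⟩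
  · exact ⟨sInf K, sSup K, hK' (hK.sInf_mem hne),
      fun x hx => ⟨csInf_le hK.bddBelow hx, le_csSup hK.bddAbove hx⟩⟩

theorem halfLineMeasure_lt_top_of_isCompact {K : Set ℝ} (hK : IsCompact K) (hK' : K ⊆ Ioi 0) :
    halfLineMeasure K < ⊤ := by
  obtain ⟨a, b, ha, h⟩ := exists_subset_Icc_of_isCompact hK hK'
  exact (measure_mono h).trans_lt (halfLineMeasure_Icc_lt_top ha)

instance : Nontrivial L2HalfLine := by
  have h1 : halfLineMeasure (Icc 1 2) ≠ ⊤ := (halfLineMeasure_Icc_lt_top one_pos).ne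
  refine ⟨indicatorConstLp 2 measurableSet_Icc h1 (1 : ℂ), 0, fun h => ?_⟩
  have h2 := congrArg norm h
  rw [norm_indicatorConstLp (by norm_num) (by norm_num), norm_zero, norm_one, one_mul] at h2
  have h3 : 0 < halfLineMeasure (Icc 1 2) := by
    rw [← measurePreserving_exp.map_eq, Measure.map_apply Real.measurable_exp measurableSet_Icc]
    have : Icc 0 (Real.log 2) ⊆ Real.exp ⁻¹' Icc 1 2 := by
      intro x hx
      refine ⟨by simpa using hx.1, ?_⟩
      have := Real.exp_le_exp.mpr hx.2
      rwa [Real.exp_log two_pos] at this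
    refine lt_of_lt_of_le ?_ (measure_mono this)
    simp [Real.volume_Icc, Real.log_pos one_lt_two]
  have h4 : 0 < halfLineMeasure.real (Icc 1 2) := ENNReal.toReal_pos h3.ne' h1
  exact (Real.rpow_pos_of_pos h4 _).ne' h2

/-! ### The representation -/

theorem norm_exp_I_mul (b y : ℝ) : ‖Complex.exp (Complex.I * b * y)‖ = 1 := by
  rw [mul_assoc, mul_comm, ← Complex.ofReal_mul]
  exact Complex.norm_exp_ofReal_mul_I _

/-- The function `y ↦ e^{iby} f(ay)`, where `g = !![a, b; 0, 1]`. -/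
def affAct (g : Aff0) (f : ℝ → ℂ) (y : ℝ) : ℂ :=
  Complex.exp (Complex.I * affB g * y) * f (affA g * y)

theorem norm_affAct (g : Aff0) (f : ℝ → ℂ) (y : ℝ) : ‖affAct g f y‖ = ‖f (affA g * y)‖ := by
  rw [affAct, norm_mul, norm_exp_I_mul, one_mul]

theorem affAct_mul (g h : Aff0) (f : ℝ → ℂ) : affAct (g * h) f = affAct g (affAct h f) := by
  funext y
  simp only [affAct, affA_mul, affB_mul]
  rw [← mul_assoc, ← Complex.exp_add]
  congr 2
  · push_cast
    ring
  · ring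

theorem affAct_one (f : ℝ → ℂ) : affAct 1 f = f := by
  funext y
  simp [affAct]

theorem affAct_add (g : Aff0) (f₁ f₂ : ℝ → ℂ) :
    affAct g (f₁ + f₂) = affAct g f₁ + affAct g f₂ := by
  funext y
  simp [affAct, mul_add]

theorem affAct_smul (g : Aff0) (c : ℂ) (f : ℝ → ℂ) : affAct g (c • f) = c • affAct g f := by
  funext y
  simp [affAct, mul_left_comm]

theorem affAct_congr_ae (g : Aff0) {f₁ f₂ : ℝ → ℂ} (h : f₁ =ᵐ[halfLineMeasure] f₂) :
    affAct g f₁ =ᵐ[halfLineMeasure] affAct g f₂ := by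
  filter_upwards [(measurePreserving_mul_left (affA_pos g)).quasiMeasurePreserving.ae_eq_comp h]
    with y hy
  rw [affAct, affAct]
  congr 1

theorem memLp_affAct (g : Aff0) {f : ℝ → ℂ} (hf : MemLp f 2 halfLineMeasure) :
    MemLp (affAct g f) 2 halfLineMeasure := by
  have h := hf.comp_measurePreserving (measurePreserving_mul_left (affA_pos g))
  refine h.of_le ?_ (ae_of_all _ fun y => (norm_affAct g f y).le)
  refine AEStronglyMeasurable.mul (Continuous.aestronglyMeasurable ?_) h.1
  fun_prop

theorem eLpNorm_affAct (g : Aff0) {f : ℝ → ℂ} (hf : MemLp f 2 halfLineMeasure) :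
    eLpNorm (affAct g f) 2 halfLineMeasure = eLpNorm f 2 halfLineMeasure := by
  rw [← eLpNorm_comp_measurePreserving hf.1 (measurePreserving_mul_left (affA_pos g))]
  exact eLpNorm_congr_norm_ae (ae_of_all _ fun y => norm_affAct g f y)

/-- The isometry of `L²(dy/y)` given by `f ↦ (y ↦ e^{iby} f(ay))`. -/
def affRepIsometry (g : Aff0) : L2HalfLine →ₗᵢ[ℂ] L2HalfLine where
  toFun φ := (memLp_affAct g (Lp.memLp φ)).toLp
  map_add' φ ψ := by
    rw [← MemLp.toLp_add]
    apply MemLp.toLp_congr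
    rw [← affAct_add]
    exact affAct_congr_ae g (Lp.coeFn_add φ ψ)
  map_smul' c φ := by
    rw [RingHom.id_apply, ← MemLp.toLp_const_smul]
    apply MemLp.toLp_congr
    rw [← affAct_smul]
    exact affAct_congr_ae g (Lp.coeFn_smul c φ)
  norm_map' φ := by
    change ‖(memLp_affAct g (Lp.memLp φ)).toLp‖ = _
    rw [Lp.norm_toLp, eLpNorm_affAct g (Lp.memLp φ), Lp.norm_def]

theorem affRepIsometry_coeFn (g : Aff0) (φ : L2HalfLine) :
    affRepIsometry g φ =ᵐ[halfLineMeasure] affAct g φ :=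
  (memLp_affAct g (Lp.memLp φ)).coeFn_toLp

theorem affRepIsometry_mul (g h : Aff0) (φ : L2HalfLine) :
    affRepIsometry (g * h) φ = affRepIsometry g (affRepIsometry h φ) := by
  apply Lp.ext
  filter_upwards [affRepIsometry_coeFn (g * h) φ, affRepIsometry_coeFn g (affRepIsometry h φ),
    affAct_congr_ae g (affRepIsometry_coeFn h φ)] with y h1 h2 h3
  rw [h1, h2, h3, affAct_mul]

theorem affRepIsometry_one (φ : L2HalfLine) : affRepIsometry 1 φ = φ := by
  apply Lp.ext
  filter_upwards [affRepIsometry_coeFn 1 φ] with y h1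
  rw [h1, affAct_one]

/-- The representation `T(g) f(y) = e^{iby} f(ay)` on `L²(dy/y)`. -/
def affRep : Aff0 →* unitary (L2HalfLine →L[ℂ] L2HalfLine) :=
  Unitary.linearIsometryEquiv.symm.toMonoidHom.comp
    { toFun := fun g =>
        { (affRepIsometry g).toLinearMap with
          invFun := affRepIsometry g⁻¹
          left_inv := fun φ => by
            change affRepIsometry g⁻¹ (affRepIsometry g φ) = φ
            rw [← affRepIsometry_mul, inv_mul_cancel, affRepIsometry_one]
          right_inv := fun φ => by
            change affRepIsometry g (affRepIsometry g⁻¹ φ) = φ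
            rw [← affRepIsometry_mul, mul_inv_cancel, affRepIsometry_one]
          norm_map' := (affRepIsometry g).norm_map }
      map_one' := by
        ext1 φ
        exact affRepIsometry_one φ
      map_mul' := fun g h => by
        ext1 φ
        exact affRepIsometry_mul g h φ }

theorem affRep_coeFn (g : Aff0) (φ : L2HalfLine) :
    (affRep g : L2HalfLine →L[ℂ] L2HalfLine) φ =ᵐ[halfLineMeasure] affAct g φ :=
  affRepIsometry_coeFn g φ

theorem norm_affRep_apply (g : Aff0) (φ : L2HalfLine) :
    ‖(affRep g : L2HalfLine →L[ℂ] L2HalfLine) φ‖ = ‖φ‖ :=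
  (affRepIsometry g).norm_map φ

theorem affRep_eq_toLp (g : Aff0) {f : ℝ → ℂ} (hf : MemLp f 2 halfLineMeasure) :
    (affRep g : L2HalfLine →L[ℂ] L2HalfLine) hf.toLp = (memLp_affAct g hf).toLp :=
  MemLp.toLp_congr (memLp_affAct g (Lp.memLp _)) _ (affAct_congr_ae g hf.coeFn_toLp)

/-! ### Generators of unitary one-parameter groups -/

section Generator

variable {E : Type*} [NormedAddCommGroup E] [InnerProductSpace ℂ E]

/-- The graph of the infinitesimal generator of `U`. -/
def generatorGraph (U : ℝ → E →L[ℂ] E) : Set (E × E) :=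
  {w : E × E | Tendsto (fun t : ℝ => (t : ℂ)⁻¹ • (U t w.1 - w.1)) (𝓝[≠] 0) (𝓝 w.2)}

theorem mem_generatorGraph_iff {U : ℝ → E →L[ℂ] E} (zero : U 0 = 1) {φ ψ : E} :
    (φ, ψ) ∈ generatorGraph U ↔ HasDerivAt (fun t => U t φ) ψ 0 := by
  rw [hasDerivAt_iff_tendsto_slope_zero, generatorGraph, mem_ofPred_eq]
  refine tendsto_congr fun t => ?_
  rw [zero_add, zero, ← Complex.ofReal_inv, Complex.coe_smul]
  rfl

theorem generatorGraph_map {U : ℝ → E →L[ℂ] E} (zero : U 0 = 1)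
    (add : ∀ s t, U (s + t) = U s * U t) {φ ψ : E} (h : (φ, ψ) ∈ generatorGraph U) (r : ℝ) :
    (U r φ, U r ψ) ∈ generatorGraph U := by
  rw [mem_generatorGraph_iff zero] at h ⊢
  have h1 := ((U r).restrictScalars ℝ).hasFDerivAt.comp_hasDerivAt (0 : ℝ) h
  refine h1.congr_deriv rfl |>.congr_of_eventuallyEq (Eventually.of_forall fun t => ?_)
  have h2 : U t * U r = U r * U t := by rw [← add, ← add, add_comm]
  exact congrArg (fun B : E →L[ℂ] E => B φ) h2

theorem hasDerivAt_of_mem_generatorGraph {U : ℝ → E →L[ℂ] E} (zero : U 0 = 1)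
    (add : ∀ s t, U (s + t) = U s * U t) {φ ψ : E} (h : (φ, ψ) ∈ generatorGraph U) (r : ℝ) :
    HasDerivAt (fun t => U t φ) (U r ψ) r := by
  have h0 := (mem_generatorGraph_iff zero).mp (generatorGraph_map zero add h r)
  have h1 : HasDerivAt (fun t => U (t - r) (U r φ)) (U r ψ) r :=
    HasDerivAt.comp_sub_const (f := fun t => U t (U r φ)) r r (by simpa using h0)
  refine h1.congr_of_eventuallyEq (Eventually.of_forall fun t => ?_)
  have h2 : U t = U (t - r) * U r := by rw [← add, sub_add_cancel]
  exact congrArg (fun B : E →L[ℂ] E => B φ) h2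

/-- `(φ, ψ)` belongs to the generator if and only if `U t φ - φ = ∫₀ᵗ U r ψ dr`, and this is a
closed condition. -/
theorem isClosed_generatorGraph [CompleteSpace E] {U : ℝ → E →L[ℂ] E} (zero : U 0 = 1)
    (add : ∀ s t, U (s + t) = U s * U t) (cont : ∀ φ, Continuous fun t => U t φ)
    (norm : ∀ t φ, ‖U t φ‖ = ‖φ‖) : IsClosed (generatorGraph U) := by
  have key : generatorGraph U =
      ⋂ t : ℝ, {w : E × E | ∫ r in (0 : ℝ)..t, U r w.2 = U t w.1 - w.1} := by
    ext ⟨φ, ψ⟩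
    simp only [mem_iInter, mem_ofPred_eq]
    constructor
    · intro h t
      rw [intervalIntegral.integral_eq_sub_of_hasDerivAt
        (fun r _ => hasDerivAt_of_mem_generatorGraph zero add h r)
        ((cont ψ).intervalIntegrable _ _), zero]
      rfl
    · intro h
      rw [mem_generatorGraph_iff zero]
      have h1 := ((cont ψ).integral_hasStrictDerivAt 0 0).hasDerivAt
      rw [zero] at h1
      have h2 := h1.add_const φ
      refine h2.congr_of_eventuallyEq (Eventually.of_forall fun t => ?_)
      simp [h t]
  rw [key]
  refine isClosed_iInter fun t => ?_
  have hlip : Continuous fun ψ : E => ∫ r in (0 : ℝ)..t, U r ψ := by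
    refine LipschitzWith.continuous (K := ⟨|t|, abs_nonneg t⟩) (LipschitzWith.of_dist_le_mul ?_)
    intro ψ₁ ψ₂
    rw [dist_eq_norm, ← intervalIntegral.integral_sub ((cont ψ₁).intervalIntegrable _ _)
      ((cont ψ₂).intervalIntegrable _ _), dist_eq_norm]
    have := intervalIntegral.norm_integral_le_of_norm_le_const (a := 0) (b := t)
      (f := fun r => U r ψ₁ - U r ψ₂) (C := ‖ψ₁ - ψ₂‖) (fun r _ => by rw [← map_sub, norm])
    rw [sub_zero, mul_comm] at this
    exact this
  exact isClosed_eq (hlip.comp continuous_snd)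
    (((U t).continuous.comp continuous_fst).sub continuous_fst)

/-- The generator of a group of isometries is skew-symmetric. -/
theorem re_inner_eq_zero_of_mem_generatorGraph {U : ℝ → E →L[ℂ] E} (zero : U 0 = 1)
    (norm : ∀ t φ, ‖U t φ‖ = ‖φ‖) {φ ψ : E} (h : (φ, ψ) ∈ generatorGraph U) :
    (inner ℂ φ ψ).re = 0 := by
  let _ : InnerProductSpace ℝ E := InnerProductSpace.rclikeToReal ℂ E
  have h1 := ((mem_generatorGraph_iff zero).mp h).norm_sq
  simp only [norm, zero] at h1
  have h2 := h1.unique (hasDerivAt_const (0 : ℝ) (‖φ‖ ^ 2))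
  have h3 : inner ℝ ((1 : E →L[ℂ] E) φ) ψ = (inner ℂ φ ψ).re := rfl
  rw [h3] at h2
  linarith

theorem generatorGraph_sub {U : ℝ → E →L[ℂ] E} (zero : U 0 = 1) {v w : E × E}
    (hv : v ∈ generatorGraph U) (hw : w ∈ generatorGraph U) : v - w ∈ generatorGraph U := by
  have h1 := (mem_generatorGraph_iff zero).mp hv
  have h2 := (mem_generatorGraph_iff zero).mp hw
  refine (mem_generatorGraph_iff zero).mpr ((h1.sub h2).congr_of_eventuallyEq ?_)
  exact Eventually.of_forall fun t => map_sub (U t) _ _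

/-- For skew-symmetric `G`, `‖φ‖ ≤ ‖G φ - φ‖`. -/
theorem norm_le_of_mem_generatorGraph {U : ℝ → E →L[ℂ] E} (zero : U 0 = 1)
    (norm : ∀ t φ, ‖U t φ‖ = ‖φ‖) {φ ψ : E} (h : (φ, ψ) ∈ generatorGraph U) :
    ‖φ‖ ≤ ‖ψ - φ‖ := by
  have h0 := re_inner_eq_zero_of_mem_generatorGraph zero norm h
  have h1 := norm_sub_sq (𝕜 := ℂ) φ ψ
  have h2 : RCLike.re (inner ℂ φ ψ) = (inner ℂ φ ψ).re := rfl
  rw [h2, h0, norm_sub_rev] at h1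
  have h3 : ‖φ‖ ^ 2 ≤ ‖ψ - φ‖ ^ 2 := by nlinarith [sq_nonneg ‖ψ‖]
  exact (sq_le_sq₀ (norm_nonneg _) (norm_nonneg _)).mp h3

/-- A densely defined restriction `A` of the generator of a unitary group whose graph is invariant
under the group is a core. A vector `η` orthogonal to the range of `A - 1` would
make `⟪η, U t φ⟫` grow like `e^t`, so that range is dense, and `G - 1` is bounded below. -/
theorem generatorGraph_eq_closure [CompleteSpace E] {U : ℝ → E →L[ℂ] E} (zero : U 0 = 1)
    (add : ∀ s t, U (s + t) = U s * U t) (cont : ∀ φ, Continuous fun t => U t φ)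
    (norm : ∀ t φ, ‖U t φ‖ = ‖φ‖) (A : Submodule ℂ (E × E))
    (hA : (A : Set (E × E)) ⊆ generatorGraph U)
    (hinv : ∀ t, ∀ w ∈ A, (U t w.1, U t w.2) ∈ A)
    (hdense : ∀ η : E, (∀ w ∈ A, inner ℂ η w.1 = 0) → η = 0) :
    generatorGraph U = closure (A : Set (E × E)) := by
  refine Subset.antisymm ?_ (closure_minimal hA (isClosed_generatorGraph zero add cont norm))
  set R : Submodule ℂ E := A.map (LinearMap.snd ℂ E E - LinearMap.fst ℂ E E) with hR
  have hRd : R.topologicalClosure = ⊤ := by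
    rw [Submodule.topologicalClosure_eq_top_iff, Submodule.eq_bot_iff]
    intro η hη
    rw [Submodule.mem_orthogonal'] at hη
    refine hdense η fun w hw => ?_
    have hd : ∀ t : ℝ, HasDerivAt (fun t => inner ℂ η (U t w.1)) (inner ℂ η (U t w.1)) t := by
      intro t
      have h1 := hasDerivAt_of_mem_generatorGraph zero add (hA hw) t
      have h2 := ((innerSL ℂ η).restrictScalars ℝ).hasFDerivAt.comp_hasDerivAt t h1
      have h3 : inner ℂ η (U t w.2) = inner ℂ η (U t w.1) := by
        have := hη _ (Submodule.mem_map_of_mem (hinv t w hw))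
        rw [← sub_eq_zero, ← inner_sub_right]
        exact this
      have h4 : HasDerivAt (fun t => inner ℂ η (U t w.1)) (inner ℂ η (U t w.2)) t := h2
      rwa [h3] at h4
    have hconst : ∀ t : ℝ, (Real.exp (-t)) • inner ℂ η (U t w.1) = inner ℂ η w.1 := by
      have hd' : ∀ t : ℝ, HasDerivAt
          (fun t : ℝ => (Real.exp (-t)) • inner ℂ η (U t w.1)) 0 t := by
        intro t
        have h1 := ((hasDerivAt_neg t).exp).smul (hd t)
        refine h1.congr_deriv ?_
        simp
      intro t
      have := is_const_of_deriv_eq_zero (fun t => (hd' t).differentiableAt)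
        (fun t => (hd' t).deriv) t 0
      simpa [zero] using this
    have hbound : ∀ t : ℝ, ‖inner ℂ η w.1‖ ≤ Real.exp (-t) * (‖η‖ * ‖w.1‖) := by
      intro t
      rw [← hconst t, norm_smul, Real.norm_of_nonneg (Real.exp_pos _).le]
      have := norm_inner_le_norm (𝕜 := ℂ) η (U t w.1)
      rw [norm] at this
      gcongr
    have hlim : Tendsto (fun t : ℝ => Real.exp (-t) * (‖η‖ * ‖w.1‖)) atTop (𝓝 0) := by
      simpa using Real.tendsto_exp_neg_atTop_nhds_zero.mul_const (‖η‖ * ‖w.1‖)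
    exact norm_le_zero_iff.mp (ge_of_tendsto' hlim hbound)
  rintro ⟨φ, ψ⟩ h
  rw [Metric.mem_closure_iff]
  intro ε hε
  have hmem : ψ - φ ∈ closure (R : Set E) := by
    rw [← Submodule.topologicalClosure_coe, hRd]
    trivial
  obtain ⟨x, ⟨w, hw, rfl⟩, hx⟩ := Metric.mem_closure_iff.mp hmem (ε / 2) (half_pos hε)
  refine ⟨w, hw, ?_⟩
  have hd := generatorGraph_sub zero h (hA hw)
  have h1 := norm_le_of_mem_generatorGraph zero norm (φ := φ - w.1) (ψ := ψ - w.2) hd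
  have h2 : ψ - w.2 - (φ - w.1) = (ψ - φ) - (w.2 - w.1) := by abel
  have hx' : ‖ψ - w.2 - (φ - w.1)‖ < ε / 2 := by
    rw [h2, ← dist_eq_norm]
    exact hx
  have h3 : ‖ψ - w.2‖ ≤ ‖ψ - w.2 - (φ - w.1)‖ + ‖φ - w.1‖ := by
    simpa using norm_add_le (ψ - w.2 - (φ - w.1)) (φ - w.1)
  rw [dist_eq_norm, Prod.norm_def]
  refine max_lt ?_ ?_
  · change ‖φ - w.1‖ < ε
    linarith
  · change ‖ψ - w.2‖ < ε
    linarith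

/-- A group with the same generator as a unitary group coincides with it: the
difference of two orbits of a vector in the domain solves `x' = G x`, `x 0 = 0`, and its norm is
constant since `G` is skew-symmetric. -/
theorem eq_of_generatorGraph_eq {U V : ℝ → E →L[ℂ] E} (zeroU : U 0 = 1)
    (addU : ∀ s t, U (s + t) = U s * U t) (zeroV : V 0 = 1)
    (addV : ∀ s t, V (s + t) = V s * V t) (normV : ∀ t φ, ‖V t φ‖ = ‖φ‖)
    (h : generatorGraph U = generatorGraph V)
    (hdense : Dense (Prod.fst '' generatorGraph V)) (t : ℝ) : U t = V t := by
  let _ : InnerProductSpace ℝ E := InnerProductSpace.rclikeToReal ℂ E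
  refine ContinuousLinearMap.ext fun φ => ?_
  refine congrFun (Continuous.ext_on hdense (U t).continuous (V t).continuous ?_) φ
  rintro _ ⟨⟨φ, ψ⟩, hφ, rfl⟩
  have hφU : (φ, ψ) ∈ generatorGraph U := h ▸ hφ
  have hd : ∀ r : ℝ, HasDerivAt (fun r => ‖U r φ - V r φ‖ ^ 2) 0 r := by
    intro r
    have h1 := (hasDerivAt_of_mem_generatorGraph zeroU addU hφU r).sub
      (hasDerivAt_of_mem_generatorGraph zeroV addV hφ r)
    refine h1.norm_sq.congr_deriv ?_
    have h2 := generatorGraph_sub zeroV (h ▸ generatorGraph_map zeroU addU hφU r)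
      (generatorGraph_map zeroV addV hφ r)
    have h3 := re_inner_eq_zero_of_mem_generatorGraph zeroV normV
      (φ := U r φ - V r φ) (ψ := U r ψ - V r ψ) h2
    have h4 : inner ℝ (U r φ - V r φ) (U r ψ - V r ψ) =
      (inner ℂ (U r φ - V r φ) (U r ψ - V r ψ)).re := rfl
    exact (congrArg (2 * ·) (h4.trans h3)).trans (mul_zero 2)
  have := is_const_of_deriv_eq_zero (fun r => (hd r).differentiableAt) (fun r => (hd r).deriv) t 0
  simp only [zeroU, zeroV, sub_self, norm_zero, ne_eq, OfNat.ofNat_ne_zero, not_false_eq_true,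
    zero_pow, pow_eq_zero_iff, norm_eq_zero, sub_eq_zero] at this
  exact this

end Generator

/-! ### Test functions on the half-line -/

namespace IsHalfLineTestFun

variable {f g : ℝ → ℂ}

theorem of_support_subset (hf : IsHalfLineTestFun f) (hg : ContDiff ℝ ∞ g)
    (h : Function.support g ⊆ tsupport f) : IsHalfLineTestFun g := by
  have h' : tsupport g ⊆ tsupport f := closure_minimal h (isClosed_tsupport f)
  exact ⟨⟨hg, hf.1.2.mono' h⟩, h'.trans hf.2⟩

theorem continuous (hf : IsHalfLineTestFun f) : Continuous f := hf.1.1.continuous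

theorem add (hf : IsHalfLineTestFun f) (hg : IsHalfLineTestFun g) : IsHalfLineTestFun (f + g) :=
  ⟨⟨hf.1.1.add hg.1.1, hf.1.2.add hg.1.2⟩,
    (tsupport_add f g).trans (union_subset hf.2 hg.2)⟩

theorem const_smul (hf : IsHalfLineTestFun f) (c : ℂ) : IsHalfLineTestFun (c • f) :=
  hf.of_support_subset (contDiff_const.smul hf.1.1)
    ((Function.support_const_smul_subset c f).trans (subset_tsupport f))

theorem exists_support_subset_Icc (hf : IsHalfLineTestFun f) :
    ∃ a b : ℝ, 0 < a ∧ ∀ y, y ∉ Icc a b → f y = 0 := by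
  obtain ⟨a, b, ha, h⟩ := exists_subset_Icc_of_isCompact hf.1.2 hf.2
  exact ⟨a, b, ha, fun y hy => image_eq_zero_of_notMem_tsupport fun h' => hy (h h')⟩

theorem exists_norm_le (hf : IsHalfLineTestFun f) : ∃ C, ∀ y, ‖f y‖ ≤ C :=
  hf.1.2.exists_bound_of_continuous hf.continuous

theorem memLp (hf : IsHalfLineTestFun f) : MemLp f 2 halfLineMeasure := by
  obtain ⟨a, b, ha, h⟩ := hf.exists_support_subset_Icc
  obtain ⟨C, hC⟩ := hf.exists_norm_le
  have h1 : (Icc a b).indicator f = f := by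
    rw [indicator_eq_self]
    intro y hy
    by_contra hy'
    exact hy (h y hy')
  rw [← h1, memLp_indicator_iff_restrict measurableSet_Icc]
  have : IsFiniteMeasure (halfLineMeasure.restrict (Icc a b)) :=
    ⟨by rw [Measure.restrict_apply_univ]; exact halfLineMeasure_Icc_lt_top ha⟩
  exact MemLp.of_bound hf.continuous.aestronglyMeasurable C (ae_of_all _ hC)

theorem affAct (hf : IsHalfLineTestFun f) (g : Aff0) : IsHalfLineTestFun (affAct g f) := by
  have ha := affA_pos g
  let m : ℝ ≃ₜ ℝ := Homeomorph.mulLeft₀ (affA g) ha.ne'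
  have hm : tsupport (f ∘ m) ⊆ Ioi 0 := by
    refine (tsupport_comp_subset_preimage f m.continuous).trans fun y hy => ?_
    exact (mul_pos_iff_of_pos_left ha).mp (hf.2 hy)
  have hfm : IsHalfLineTestFun (f ∘ m) := by
    refine ⟨⟨hf.1.1.comp ?_, hf.1.2.comp_homeomorph m⟩, hm⟩
    exact contDiff_const.mul contDiff_id
  refine hfm.of_support_subset (ContDiff.mul ?_ hfm.1.1)
    ((Function.support_mul_subset_right _ _).trans (subset_tsupport _))
  exact (contDiff_const.mul Complex.ofRealCLM.contDiff).cexp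

end IsHalfLineTestFun

/-- Half-line test functions are dense in `L²(dy/y)`. -/
theorem eq_zero_of_inner_testFun_eq_zero (η : L2HalfLine)
    (h : ∀ f (hf : IsHalfLineTestFun f), inner ℂ η hf.memLp.toLp = 0) : η = 0 := by
  have hloc : LocallyIntegrableOn (fun y => (starRingEnd ℂ) (η y)) (Ioi 0) halfLineMeasure := by
    rw [locallyIntegrableOn_iff isOpen_Ioi.isLocallyClosed]
    intro K hKs hK
    have : IsFiniteMeasure (halfLineMeasure.restrict K) :=
      ⟨by rw [Measure.restrict_apply_univ]; exact halfLineMeasure_lt_top_of_isCompact hK hKs⟩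
    exact ((Lp.memLp η).star.restrict K).integrable (by norm_num)
  have h1 := isOpen_Ioi.ae_eq_zero_of_integral_contDiff_smul_eq_zero hloc (by
    intro g hg hgc hgs
    have hf : IsHalfLineTestFun fun y => (g y : ℂ) :=
      ⟨⟨Complex.ofRealCLM.contDiff.comp hg, hgc.comp_left (g := Complex.ofReal) rfl⟩,
        (closure_mono (Function.support_comp_subset (g := Complex.ofReal) rfl g)).trans hgs⟩
    have h2 := h _ hf
    rw [L2.inner_def] at h2
    rw [← h2]
    refine integral_congr_ae ?_
    filter_upwards [hf.memLp.coeFn_toLp] with y hy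
    rw [hy, RCLike.inner_apply, Complex.real_smul])
  rw [Lp.eq_zero_iff_ae_eq_zero]
  filter_upwards [h1, ae_pos_halfLineMeasure] with y hy hy'
  exact (map_eq_zero _).mp (hy hy')

/-- Dominated convergence in `L²(dy/y)`, for functions supported in a fixed compact interval. -/
theorem tendsto_toLp_of_dominated {ι : Type*} {l : Filter ι} [l.IsCountablyGenerated]
    {F : ι → ℝ → ℂ} {G : ℝ → ℂ} (hF : ∀ i, MemLp (F i) 2 halfLineMeasure)
    (hG : MemLp G 2 halfLineMeasure) (hFm : ∀ i, Measurable (F i)) (hGm : Measurable G)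
    {a b C : ℝ} (ha : 0 < a) (hC : ∀ᶠ i in l, ∀ y, ‖F i y - G y‖ ≤ C)
    (hsupp : ∀ᶠ i in l, ∀ y, y ∉ Icc a b → F i y - G y = 0)
    (hlim : ∀ y, Tendsto (fun i => F i y) l (𝓝 (G y))) :
    Tendsto (fun i => (hF i).toLp) l (𝓝 hG.toLp) := by
  rw [Lp.tendsto_Lp_iff_tendsto_eLpNorm'']
  simp only [eLpNorm_eq_lintegral_rpow_enorm_toReal two_ne_zero ENNReal.ofNat_ne_top,
    ENNReal.toReal_ofNat, ENNReal.rpow_ofNat]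
  have key : Tendsto (fun i => ∫⁻ y, ‖(F i - G) y‖ₑ ^ 2 ∂halfLineMeasure) l
      (𝓝 (∫⁻ _, 0 ∂halfLineMeasure)) := by
    refine tendsto_lintegral_filter_of_dominated_convergence
      ((Icc a b).indicator fun _ => ENNReal.ofReal C ^ 2)
      (Eventually.of_forall fun i => ((hFm i).sub hGm).enorm.pow_const 2) ?_ ?_ ?_
    · filter_upwards [hC, hsupp] with i hi hi'
      refine ae_of_all _ fun y => ?_
      by_cases hy : y ∈ Icc a b
      · rw [indicator_of_mem hy]
        gcongr
        rw [← ofReal_norm]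
        exact ENNReal.ofReal_le_ofReal (hi y)
      · rw [indicator_of_notMem hy, Pi.sub_apply, hi' y hy]
        simp
    · rw [lintegral_indicator measurableSet_Icc, lintegral_const, Measure.restrict_apply_univ]
      exact ENNReal.mul_ne_top (by simp) (halfLineMeasure_Icc_lt_top ha).ne
    · refine ae_of_all _ fun y => ?_
      have h1 : Tendsto (fun i => ‖F i y - G y‖ₑ ^ 2) l (𝓝 (‖G y - G y‖ₑ ^ 2)) :=
        (ENNReal.continuous_pow 2).tendsto _ |>.comp
          (continuous_enorm.tendsto _ |>.comp ((hlim y).sub_const _))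
      simpa using h1
  rw [lintegral_zero] at key
  have := key.ennrpow_const (1 / 2 : ℝ)
  rwa [ENNReal.zero_rpow_of_pos (by norm_num)] at this

theorem dense_testFun :
    Dense {φ : L2HalfLine | ∃ f, ∃ hf : IsHalfLineTestFun f, φ = hf.memLp.toLp} := by
  let S : Submodule ℂ L2HalfLine :=
    { carrier := {φ | ∃ f, ∃ hf : IsHalfLineTestFun f, φ = hf.memLp.toLp}
      zero_mem' := ⟨0, ⟨⟨contDiff_const, HasCompactSupport.zero⟩, by simp [tsupport]⟩, by
        rw [MemLp.toLp_zero]⟩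
      add_mem' := by
        rintro _ _ ⟨f, hf, rfl⟩ ⟨g, hg, rfl⟩
        exact ⟨f + g, hf.add hg, (MemLp.toLp_add _ _).symm⟩
      smul_mem' := by
        rintro c _ ⟨f, hf, rfl⟩
        exact ⟨c • f, hf.const_smul c, (MemLp.toLp_const_smul c _).symm⟩ }
  have h : S.topologicalClosure = ⊤ := by
    rw [Submodule.topologicalClosure_eq_top_iff, Submodule.eq_bot_iff]
    intro η hη
    rw [Submodule.mem_orthogonal'] at hη
    exact eq_zero_of_inner_testFun_eq_zero η fun f hf => hη _ ⟨f, hf, rfl⟩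
  intro φ
  have : φ ∈ S.topologicalClosure := by rw [h]; trivial
  exact this

/-! ### Strong continuity -/

instance : FirstCountableTopology Aff0 := by
  have h0 : SecondCountableTopology (Matrix (Fin 2) (Fin 2) ℝ) :=
    inferInstanceAs (SecondCountableTopology (Fin 2 → Fin 2 → ℝ))
  have h1 : SecondCountableTopology (Matrix (Fin 2) (Fin 2) ℝ)ᵐᵒᵖ :=
    MulOpposite.opHomeomorph.symm.secondCountableTopology
  have h2 : SecondCountableTopology (GL (Fin 2) ℝ) :=
    Units.isEmbedding_embedProduct.secondCountableTopology
  exact (Topology.IsInducing.subtypeVal (t := (Aff0 : Set (GL (Fin 2) ℝ)))).firstCountableTopology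

theorem continuous_coe_apply (i j : Fin 2) :
    Continuous fun g : Aff0 => ((g : GL (Fin 2) ℝ) : Matrix (Fin 2) (Fin 2) ℝ) i j :=
  (Continuous.matrix_elem continuous_id i j).comp
    (Units.continuous_val.comp continuous_subtype_val)

theorem continuous_affA : Continuous affA := continuous_coe_apply 0 0

theorem continuous_affB : Continuous affB := continuous_coe_apply 0 1

theorem continuous_aff0_mk {a b : ℝ → ℝ} (ha : Continuous a) (hb : Continuous b)
    (hpos : ∀ x, 0 < a x) : Continuous fun x => Aff0.mk (a x) (b x) (hpos x) := by
  have hi : Continuous fun x => (a x)⁻¹ := ha.inv₀ fun x => (hpos x).ne'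
  refine Continuous.subtype_mk (Units.continuous_iff.mpr ⟨?_, ?_⟩) _
  · refine continuous_matrix fun i j => ?_
    fin_cases i <;> fin_cases j <;> simp <;> fun_prop
  · refine continuous_matrix fun i j => ?_
    fin_cases i <;> fin_cases j <;> simp <;> fun_prop

theorem affAct_eq_zero {f : ℝ → ℂ} {m M a₁ a₂ : ℝ} (hm : 0 < m)
    (hf : ∀ y, y ∉ Icc m M → f y = 0) (ha : 0 < a₁) {g : Aff0} (hg : affA g ∈ Icc a₁ a₂)
    {y : ℝ} (hy : y ∉ Icc (m / a₂) (M / a₁)) : affAct g f y = 0 := by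
  rw [affAct, hf, mul_zero]
  intro h
  have ha₂ : 0 < a₂ := ha.trans_le (hg.1.trans hg.2)
  have hypos : 0 < y := pos_of_mul_pos_right (hm.trans_le h.1) (affA_pos g).le
  refine hy ⟨?_, ?_⟩
  · rw [div_le_iff₀ ha₂, mul_comm]
    exact h.1.trans (mul_le_mul_of_nonneg_right hg.2 hypos.le)
  · rw [le_div_iff₀ ha, mul_comm]
    exact (mul_le_mul_of_nonneg_right hg.1 hypos.le).trans h.2

theorem continuous_affRep_testFun {f : ℝ → ℂ} (hf : IsHalfLineTestFun f) :
    Continuous fun g => (affRep g : L2HalfLine →L[ℂ] L2HalfLine) hf.memLp.toLp := by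
  simp only [affRep_eq_toLp]
  rw [continuous_iff_continuousAt]
  intro g₀
  obtain ⟨m, M, hm, hsupp⟩ := hf.exists_support_subset_Icc
  obtain ⟨C, hC⟩ := hf.exists_norm_le
  have ha := affA_pos g₀
  have hnear : ∀ᶠ g in 𝓝 g₀, affA g ∈ Icc (affA g₀ / 2) (2 * affA g₀) :=
    continuous_affA.continuousAt.eventually_mem
      (Icc_mem_nhds (half_lt_self ha) (by linarith))
  refine tendsto_toLp_of_dominated (fun g => memLp_affAct g hf.memLp)
    (memLp_affAct g₀ hf.memLp) (fun g => (hf.affAct g).continuous.measurable)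
    (hf.affAct g₀).continuous.measurable (a := m / (2 * affA g₀)) (b := M / (affA g₀ / 2))
    (C := C + C) (by positivity) (Eventually.of_forall fun g y => ?_) ?_ fun y => ?_
  · refine (norm_sub_le _ _).trans ?_
    rw [norm_affAct, norm_affAct]
    exact add_le_add (hC _) (hC _)
  · filter_upwards [hnear] with g hg y hy
    rw [affAct_eq_zero hm hsupp (half_pos ha) hg hy,
      affAct_eq_zero hm hsupp (half_pos ha) hnear.self_of_nhds hy, sub_zero]
  · have h1 := continuous_affA
    have h2 := continuous_affB
    have h3 := hf.continuous
    have : Continuous fun g => affAct g f y := by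
      unfold affAct
      fun_prop
    exact this.continuousAt

theorem continuous_affRep (φ : L2HalfLine) :
    Continuous fun g => (affRep g : L2HalfLine →L[ℂ] L2HalfLine) φ := by
  refine continuous_of_uniform_approx_of_continuous fun u hu => ?_
  obtain ⟨ε, hε, h⟩ := Metric.mem_uniformity_dist.mp hu
  obtain ⟨_, hd, f, hf, rfl⟩ := Metric.dense_iff.mp dense_testFun φ ε hε
  refine ⟨_, continuous_affRep_testFun hf, fun g => h ?_⟩
  rw [dist_eq_norm, ← map_sub, norm_affRep_apply, ← dist_eq_norm, dist_comm]
  exact hd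

/-! ### The infinitesimal generators -/

/-- The first-order operator `α y ∂_y + i β y`, where `Z = α X + β Y`. -/
def ellOp (Z : aff) (f : ℝ → ℂ) (y : ℝ) : ℂ :=
  (Z.1 0 0 * y : ℝ) * deriv f y + Complex.I * (Z.1 0 1 * y : ℝ) * f y

theorem IsHalfLineTestFun.differentiable {f : ℝ → ℂ} (hf : IsHalfLineTestFun f) :
    Differentiable ℝ f := hf.1.1.differentiable (by simp)

theorem IsHalfLineTestFun.ellOp {f : ℝ → ℂ} (hf : IsHalfLineTestFun f) (Z : aff) :
    IsHalfLineTestFun (ellOp Z f) := by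
  refine hf.of_support_subset ?_ ?_
  · have h1 : ContDiff ℝ ∞ (deriv f) := ((contDiff_infty_iff_deriv).mp hf.1.1).2
    have h2 : ∀ c : ℝ, ContDiff ℝ ∞ fun y : ℝ => ((c * y : ℝ) : ℂ) := fun c =>
      Complex.ofRealCLM.contDiff.comp (contDiff_const.mul contDiff_id)
    exact ((h2 _).mul h1).add ((contDiff_const.mul (h2 _)).mul hf.1.1)
  · intro y hy
    by_contra h
    refine hy ?_
    have h1 : deriv f y = 0 := by
      by_contra h'
      exact h (support_deriv_subset h')
    rw [_root_.ellOp, h1, image_eq_zero_of_notMem_tsupport h, mul_zero, mul_zero, add_zero]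

theorem ellOp_add (Z : aff) {f g : ℝ → ℂ} (hf : Differentiable ℝ f) (hg : Differentiable ℝ g) :
    ellOp Z (f + g) = ellOp Z f + ellOp Z g := by
  funext y
  simp only [ellOp, Pi.add_apply, deriv_add (hf y) (hg y)]
  ring

theorem ellOp_smul (Z : aff) (c : ℂ) (f : ℝ → ℂ) : ellOp Z (c • f) = c • ellOp Z f := by
  funext y
  simp only [ellOp, Pi.smul_apply, deriv_const_smul_field, smul_eq_mul]
  ring

theorem hasDerivAt_affAct (Z : aff) {f : ℝ → ℂ} (hf : Differentiable ℝ f) (y t : ℝ) :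
    HasDerivAt (fun t : ℝ => affAct (affExp (t • Z)) f y)
      (affAct (affExp (t • Z)) (ellOp Z f) y) t := by
  simp only [affAct, affA_affExp_smul, affB_affExp_smul]
  set α := Z.1 0 0 with hα
  set β := Z.1 0 1 with hβ
  have h1 : HasDerivAt (fun t : ℝ => Real.exp (t * α) * y) (α * (Real.exp (t * α) * y)) t := by
    refine ((((hasDerivAt_id' t).mul_const α).exp).mul_const y).congr_deriv ?_
    ring
  have h2 := (hf (Real.exp (t * α) * y)).hasDerivAt.scomp t h1
  have h3 := (((hasDerivAt_mul_expQuot α t).const_mul β).ofReal_comp.const_mul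
    Complex.I).mul_const (y : ℂ) |>.cexp
  refine (h3.mul h2).congr_deriv ?_
  simp only [ellOp, Function.comp_apply, Complex.real_smul]
  push_cast
  ring

/-- The one-parameter group `t ↦ T (exp t Z)`. -/
def affFlow (Z : aff) (t : ℝ) : L2HalfLine →L[ℂ] L2HalfLine := affRep (affExp (t • Z))

theorem affExp_zero : affExp 0 = 1 := by
  apply Aff0.ext_entries <;> simp

theorem affFlow_zero (Z : aff) : affFlow Z 0 = 1 := by
  rw [affFlow, zero_smul, affExp_zero, map_one]
  rfl

theorem affFlow_add (Z : aff) (s t : ℝ) : affFlow Z (s + t) = affFlow Z s * affFlow Z t := by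
  rw [affFlow, affExp_add_smul, map_mul]
  rfl

theorem norm_affFlow (Z : aff) (t : ℝ) (φ : L2HalfLine) : ‖affFlow Z t φ‖ = ‖φ‖ :=
  norm_affRep_apply _ φ

theorem continuous_affFlow (Z : aff) (φ : L2HalfLine) : Continuous fun t => affFlow Z t φ := by
  have h : Continuous fun t : ℝ => affExp (t • Z) := by
    have h1 : (fun t : ℝ => affExp (t • Z)) = fun t => Aff0.mk (Real.exp (t * Z.1 0 0))
        (Z.1 0 1 * (t * expQuot (t * Z.1 0 0))) (Real.exp_pos _) := by
      funext t
      apply Aff0.ext_entries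
      · rw [affA_affExp_smul, affA_mk]
      · rw [affB_affExp_smul, affB_mk]
    have h2 : Continuous fun t : ℝ => t * expQuot (t * Z.1 0 0) :=
      continuous_iff_continuousAt.mpr fun t => (hasDerivAt_mul_expQuot _ t).continuousAt
    rw [h1]
    exact continuous_aff0_mk (by fun_prop) (continuous_const.mul h2) _
  exact (continuous_affRep φ).comp h

/-- The graph of `α y ∂_y + i β y` on half-line test functions. -/
def ellGraph (Z : aff) : Submodule ℂ (L2HalfLine × L2HalfLine) where
  carrier := {w | ∃ f, ∃ hf : IsHalfLineTestFun f,
    w = (hf.memLp.toLp, (hf.ellOp Z).memLp.toLp)}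
  zero_mem' := by
    have h0 : IsHalfLineTestFun 0 :=
      ⟨⟨contDiff_const, HasCompactSupport.zero⟩, by simp [tsupport]⟩
    refine ⟨0, h0, ?_⟩
    have h1 : ellOp Z 0 = 0 := by
      funext y
      simp [ellOp]
    simp only [h1, MemLp.toLp_zero]
    rfl
  add_mem' := by
    rintro _ _ ⟨f, hf, rfl⟩ ⟨g, hg, rfl⟩
    refine ⟨f + g, hf.add hg, ?_⟩
    simp only [ellOp_add Z hf.differentiable hg.differentiable]
    rfl
  smul_mem' := by
    rintro c _ ⟨f, hf, rfl⟩
    refine ⟨c • f, hf.const_smul c, ?_⟩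
    simp only [ellOp_smul]
    rfl

/-- Difference quotients of the flow converge pointwise, and the mean value inequality
bounds them by `sup |α y f' + i β y f|`. -/
theorem ellGraph_subset_generatorGraph (Z : aff) :
    (ellGraph Z : Set (L2HalfLine × L2HalfLine)) ⊆ generatorGraph (affFlow Z) := by
  rintro _ ⟨f, hf, rfl⟩
  obtain ⟨m, M, hm, hsupp⟩ := hf.exists_support_subset_Icc
  obtain ⟨C, hC⟩ := (hf.ellOp Z).exists_norm_le
  set α := Z.1 0 0 with hα
  have hmem : ∀ t : ℝ, MemLp ((t : ℂ)⁻¹ • (affAct (affExp (t • Z)) f - f)) 2 halfLineMeasure :=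
    fun t => ((memLp_affAct _ hf.memLp).sub hf.memLp).const_smul _
  have heq : ∀ t : ℝ, (t : ℂ)⁻¹ • (affFlow Z t hf.memLp.toLp - hf.memLp.toLp) =
      (hmem t).toLp := by
    intro t
    rw [affFlow, affRep_eq_toLp]
    rfl
  have hC0 : 0 ≤ C := (norm_nonneg _).trans (hC 0)
  have hmvt : ∀ y t : ℝ, ‖affAct (affExp (t • Z)) f y - f y‖ ≤ C * |t| := by
    intro y t
    have := Convex.norm_image_sub_le_of_norm_hasDerivWithin_le (s := univ) (x := 0) (y := t)
      (fun r _ => (hasDerivAt_affAct Z hf.differentiable y r).hasDerivWithinAt)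
      (fun r _ => (norm_affAct _ _ _).trans_le (hC _)) convex_univ (mem_univ _) (mem_univ _)
    simpa [affExp_zero, affAct_one] using this
  change Tendsto (fun t : ℝ => (t : ℂ)⁻¹ • (affFlow Z t hf.memLp.toLp - hf.memLp.toLp))
    (𝓝[≠] 0) (𝓝 (hf.ellOp Z).memLp.toLp)
  simp only [heq]
  have hE : ∀ t ∈ Ioo (-1 : ℝ) 1, affA (affExp (t • Z)) ∈ Icc (Real.exp (-|α|)) (Real.exp |α|) := by
    intro t ht
    rw [affA_affExp_smul, ← hα]
    have h1 : |t * α| ≤ |α| := by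
      rw [abs_mul]
      exact mul_le_of_le_one_left (abs_nonneg _) (abs_le.mpr ⟨ht.1.le, ht.2.le⟩)
    exact ⟨Real.exp_le_exp.mpr (abs_le.mp h1).1, Real.exp_le_exp.mpr (abs_le.mp h1).2⟩
  refine tendsto_toLp_of_dominated hmem (hf.ellOp Z).memLp
    (fun t => (((hf.affAct _).continuous.sub hf.continuous).const_smul _).measurable)
    (hf.ellOp Z).continuous.measurable
    (a := m / Real.exp |α|) (b := M / Real.exp (-|α|)) (C := C + C) (by positivity) ?_ ?_ ?_
  · filter_upwards [self_mem_nhdsWithin] with t ht y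
    refine (norm_sub_le _ _).trans (add_le_add ?_ (hC y))
    rw [Pi.smul_apply, Pi.sub_apply, norm_smul, norm_inv, Complex.norm_real, Real.norm_eq_abs,
      inv_mul_le_iff₀ (abs_pos.mpr ht), mul_comm]
    exact hmvt y t
  · filter_upwards [nhdsWithin_le_nhds (Ioo_mem_nhds (by norm_num) (by norm_num) :
      Ioo (-1 : ℝ) 1 ∈ 𝓝 0)] with t ht y hy
    have h0 : (0 : ℝ) ∈ Ioo (-1 : ℝ) 1 := by norm_num
    have h1 := affAct_eq_zero hm hsupp (Real.exp_pos _) (hE t ht) hy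
    have h2 := affAct_eq_zero hm hsupp (Real.exp_pos _) (hE 0 h0) hy
    have h3 : ellOp Z f y = 0 := by
      have hnear : affAct (affExp ((0 : ℝ) • Z)) (ellOp Z f) y = ellOp Z f y := by
        rw [zero_smul, affExp_zero, affAct_one]
      rw [← hnear]
      have hd := hasDerivAt_affAct Z hf.differentiable y 0
      refine hd.unique ((hasDerivAt_const (0 : ℝ) (0 : ℂ)).congr_of_eventuallyEq ?_)
      filter_upwards [Ioo_mem_nhds (show (-1 : ℝ) < 0 by norm_num) (show (0 : ℝ) < 1 by norm_num)]
        with r hr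
      exact affAct_eq_zero hm hsupp (Real.exp_pos _) (hE r hr) hy
    rw [zero_smul, affExp_zero, affAct_one] at h2
    simp [h1, h2, h3]
  · intro y
    have h1 := hasDerivAt_affAct Z hf.differentiable y 0
    rw [hasDerivAt_iff_tendsto_slope_zero, zero_smul, affExp_zero, affAct_one, affAct_one] at h1
    refine h1.congr fun t => ?_
    rw [zero_add, Pi.smul_apply, Pi.sub_apply, smul_eq_mul, Complex.real_smul, Complex.ofReal_inv]

theorem ellOp_affAct (Z : aff) {f : ℝ → ℂ} (hf : Differentiable ℝ f) (t : ℝ) :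
    ellOp Z (affAct (affExp (t • Z)) f) = affAct (affExp (t • Z)) (ellOp Z f) := by
  funext y
  have hg : Differentiable ℝ (affAct (affExp (t • Z)) f) := by
    have h1 : Differentiable ℝ fun y : ℝ => (y : ℂ) := Complex.ofRealCLM.differentiable
    unfold affAct
    fun_prop
  have h1 := hasDerivAt_affAct Z hg y 0
  rw [zero_smul, affExp_zero, affAct_one] at h1
  have h2 : HasDerivAt (fun r : ℝ => affAct (affExp ((r + t) • Z)) f y)
      (affAct (affExp ((0 + t) • Z)) (ellOp Z f) y) 0 :=
    HasDerivAt.comp_add_const 0 t (hasDerivAt_affAct Z hf y (0 + t))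
  rw [zero_add] at h2
  refine h1.unique (h2.congr_of_eventuallyEq (Eventually.of_forall fun r => ?_))
  simp only [affExp_add_smul, affAct_mul]

theorem generatorGraph_affFlow (Z : aff) :
    generatorGraph (affFlow Z) = closure (ellGraph Z : Set (L2HalfLine × L2HalfLine)) := by
  refine generatorGraph_eq_closure (affFlow_zero Z) (affFlow_add Z) (continuous_affFlow Z)
    (norm_affFlow Z) _ (ellGraph_subset_generatorGraph Z) ?_ ?_
  · rintro t _ ⟨f, hf, rfl⟩
    refine ⟨_, hf.affAct (affExp (t • Z)), ?_⟩
    simp only [affFlow, affRep_eq_toLp, ellOp_affAct Z hf.differentiable]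
  · intro η hη
    exact eq_zero_of_inner_testFun_eq_zero η fun f hf => hη _ ⟨f, hf, rfl⟩

/-- `T (exp t Z)` is the exponential of `t (α y ∂_y + i β y)`, and the only one. -/
theorem isExpGroup_ellGraph_iff (Z : aff) (U : ℝ → L2HalfLine →L[ℂ] L2HalfLine) :
    IsExpGroup (ellGraph Z : Set (L2HalfLine × L2HalfLine)) U ↔ ∀ t, U t = affFlow Z t := by
  constructor
  · intro h
    have hgen : generatorGraph U = generatorGraph (affFlow Z) :=
      h.generator.trans (generatorGraph_affFlow Z).symm
    refine eq_of_generatorGraph_eq h.zero h.add (affFlow_zero Z) (affFlow_add Z)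
      (norm_affFlow Z) hgen (dense_testFun.mono ?_)
    rintro _ ⟨f, hf, rfl⟩
    exact ⟨_, ellGraph_subset_generatorGraph Z ⟨f, hf, rfl⟩, rfl⟩
  · intro h
    obtain rfl : U = affFlow Z := funext h
    exact ⟨affFlow_zero Z, affFlow_add Z, continuous_affFlow Z, generatorGraph_affFlow Z⟩

/-! ### The bidifferential operators applied to a Hamiltonian function -/

theorem mderiv_zero (I : Fin 0 → Fin 2) (u : ℝ × ℝ → ℂ) : mderiv I u = u := by
  simp [mderiv]

theorem mderiv_succ {r : ℕ} (I : Fin (r + 1) → Fin 2) (u : ℝ × ℝ → ℂ) :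
    mderiv I u = pderiv2 (I 0) (mderiv (fun k => I k.succ) u) := by
  simp [mderiv, List.ofFn_succ]

theorem pderiv2_const (i : Fin 2) (c : ℂ) : pderiv2 i (fun _ => c) = fun _ => 0 := by
  funext z
  simp [pderiv2]

/-- The function `i Z̃` of the coordinates `(p, q)`. -/
def iHam (Z : aff) (z : ℝ × ℝ) : ℂ := Complex.I * hamiltonian Z z

theorem iHam_apply (Z : aff) (z : ℝ × ℝ) :
    iHam Z z = Complex.I * (Z.1 0 0 * z.1 + Z.1 0 1 * Real.exp z.2) := by
  have h1 : affXstar Z = Z.1 0 0 := rfl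
  have h2 : affYstar Z = Z.1 0 1 := rfl
  simp only [iHam, hamiltonian, darboux, LinearMap.add_apply, LinearMap.smul_apply, h1, h2,
    smul_eq_mul]
  push_cast
  ring

/-- The function `∂_q^r (i Z̃)`, `r ≥ 1`. -/
def iHamQ (Z : aff) (z : ℝ × ℝ) : ℂ := Complex.I * Z.1 0 1 * Real.exp z.2

theorem hasDerivAt_ofReal_exp (c : ℂ) (q : ℝ) :
    HasDerivAt (fun q : ℝ => c * (Real.exp q : ℂ)) (c * Real.exp q) q :=
  ((Real.hasDerivAt_exp q).ofReal_comp).const_mul c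

theorem pderiv2_one_iHamQ (Z : aff) : pderiv2 1 (iHamQ Z) = iHamQ Z := by
  funext z
  simpa [pderiv2, iHamQ] using (hasDerivAt_ofReal_exp (Complex.I * Z.1 0 1) z.2).deriv

theorem pderiv2_zero_iHamQ (Z : aff) : pderiv2 0 (iHamQ Z) = fun _ => 0 := by
  funext z
  simp [pderiv2, iHamQ]

theorem pderiv2_one_iHam (Z : aff) : pderiv2 1 (iHam Z) = iHamQ Z := by
  funext z
  have h := ((hasDerivAt_ofReal_exp (Z.1 0 1) z.2).const_add (Z.1 0 0 * z.1 : ℂ)).const_mul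
    Complex.I
  simp only [pderiv2, iHam_apply, iHamQ, one_ne_zero, if_false]
  rw [h.deriv, mul_assoc]

theorem pderiv2_zero_iHam (Z : aff) :
    pderiv2 0 (iHam Z) = fun _ => Complex.I * Z.1 0 0 := by
  funext z
  have h := ((((hasDerivAt_id' z.1).ofReal_comp).const_mul (Z.1 0 0 : ℂ)).add_const
    (Z.1 0 1 * Real.exp z.2 : ℂ)).const_mul Complex.I
  simp only [pderiv2, iHam_apply, if_true]
  rw [h.deriv, Complex.ofReal_one, mul_one]

theorem mderiv_one_iHam (Z : aff) (r : ℕ) :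
    mderiv (fun _ : Fin (r + 1) => 1) (iHam Z) = iHamQ Z := by
  induction r with
  | zero => rw [mderiv_succ, mderiv_zero, pderiv2_one_iHam]
  | succ r ih => rw [mderiv_succ, ih, pderiv2_one_iHamQ]

theorem mderiv_iHam_eq_zero (Z : aff) (r : ℕ) (I : Fin (r + 2) → Fin 2) (hI : I ≠ fun _ => 1) :
    mderiv I (iHam Z) = fun _ => 0 := by
  have h2 : ∀ i : Fin 2, i = 0 ∨ i = 1 := by decide
  induction r with
  | zero =>
    rw [mderiv_succ, mderiv_succ, mderiv_zero]
    rcases h2 (I (Fin.succ 0)) with h1 | h1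
    · simp only [h1, pderiv2_zero_iHam, pderiv2_const]
    · rcases h2 (I 0) with h0 | h0
      · simp only [h1, h0, pderiv2_one_iHam, pderiv2_zero_iHamQ]
      · refine absurd ?_ hI
        funext k
        fin_cases k
        · exact h0
        · exact h1
  | succ r ih =>
    rw [mderiv_succ]
    by_cases h : (fun k => I (Fin.succ k)) = fun _ => 1
    · rw [h, mderiv_one_iHam]
      rcases h2 (I 0) with h0 | h0
      · simp only [h0, pderiv2_zero_iHamQ]
      · refine absurd ?_ hI
        funext k
        refine Fin.cases h0 (fun j => ?_) k
        exact congrFun h j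
    · rw [ih _ h, pderiv2_const]

theorem bidiff_iHam_zero (Z : aff) (v : ℝ × ℝ → ℂ) (z : ℝ × ℝ) :
    bidiff 0 (iHam Z) v z = iHam Z z * v z := by
  simp [bidiff, mderiv_zero]

theorem bidiff_iHam_one (Z : aff) (v : ℝ × ℝ → ℂ) (z : ℝ × ℝ) :
    bidiff 1 (iHam Z) v z =
      Complex.I * Z.1 0 0 * pderiv2 1 v z - iHamQ Z z * pderiv2 0 v z := by
  have hu : (Finset.univ : Finset (Fin 1 → Fin 2)) = {![0], ![1]} := by decide
  have hne : (![0] : Fin 1 → Fin 2) ≠ ![1] := by decide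
  simp only [bidiff, hu, Finset.sum_pair hne, mderiv_succ, mderiv_zero, Finset.univ_unique,
    Finset.prod_singleton, Fin.default_eq_zero, Matrix.cons_val_zero, pderiv2_zero_iHam,
    pderiv2_one_iHam, poissonTensor, Matrix.of_apply, Matrix.cons_val', Matrix.cons_val_one,
    Matrix.cons_val_fin_one]
  ring

/-- Only `∂_q^r (i Z̃) = i β e^q` survives in the `r`-th term, `r ≥ 2`. -/
theorem bidiff_iHam_add_two (Z : aff) (v : ℝ × ℝ → ℂ) (r : ℕ) (z : ℝ × ℝ) :
    bidiff (r + 2) (iHam Z) v z =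
      (-1) ^ (r + 2) * iHamQ Z z * mderiv (fun _ : Fin (r + 2) => 0) v z := by
  rw [bidiff, Finset.sum_eq_single (fun _ => 1), Finset.sum_eq_single (fun _ => 0),
    mderiv_one_iHam]
  · simp [poissonTensor]
  · intro J _ hJ
    obtain ⟨k, hk⟩ := Function.ne_iff.mp hJ
    have h2 : ∀ i : Fin 2, i ≠ 0 → i = 1 := by decide
    have hk1 : J k = 1 := h2 _ hk
    rw [Finset.prod_eq_zero (Finset.mem_univ k) (by simp [hk1, poissonTensor]), zero_mul, zero_mul]
  · simp
  · intro I _ hI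
    rw [mderiv_iHam_eq_zero Z r I hI]
    simp
  · simp

/-! ### The partial Fourier transform of test functions -/

/-- Differentiation under the integral sign, for integrands supported in a fixed bounded set. -/
theorem hasDerivAt_integral_of_bounded_support {g g' : ℝ → ℝ → ℂ}
    (hg : Continuous (Function.uncurry g)) (hg' : Continuous (Function.uncurry g')) {R : ℝ}
    (hs : ∀ τ x, R < |x| → g τ x = 0) (hs' : ∀ τ x, R < |x| → g' τ x = 0)
    (hd : ∀ τ x, HasDerivAt (fun τ => g τ x) (g' τ x) τ) (τ₀ : ℝ) :
    HasDerivAt (fun τ => ∫ x, g τ x) (∫ x, g' τ₀ x) τ₀ := by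
  obtain ⟨C, hC⟩ := ((isCompact_Icc (a := τ₀ - 1) (b := τ₀ + 1)).prod
    (isCompact_Icc (a := -R) (b := R))).exists_bound_of_continuousOn hg'.continuousOn
  have hslice : ∀ {k : ℝ → ℝ → ℂ}, Continuous (Function.uncurry k) → ∀ τ, Continuous (k τ) :=
    fun hk τ => hk.comp (Continuous.prodMk_right τ)
  refine (hasDerivAt_integral_of_dominated_loc_of_deriv_le (bound := (Icc (-R) R).indicator
    fun _ => C) (Icc_mem_nhds (by linarith : τ₀ - 1 < τ₀) (by linarith : τ₀ < τ₀ + 1))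
    (Eventually.of_forall fun τ => (hslice hg τ).aestronglyMeasurable) ?_
    (hslice hg' τ₀).aestronglyMeasurable (ae_of_all _ fun x τ hτ => ?_) ?_
    (ae_of_all _ fun x τ _ => hd τ x)).2
  · refine (hslice hg τ₀).integrable_of_hasCompactSupport
      (HasCompactSupport.intro (isCompact_Icc (a := -R) (b := R)) fun x hx => hs τ₀ x ?_)
    by_contra h
    exact hx (abs_le.mp (not_lt.mp h))
  · by_cases hx : x ∈ Icc (-R) R
    · rw [indicator_of_mem hx]
      exact hC (τ, x) ⟨hτ, hx⟩
    · rw [indicator_of_notMem hx, hs' τ x, norm_zero]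
      by_contra h
      exact hx (abs_le.mp (not_lt.mp h))
  · rw [integrable_indicator_iff measurableSet_Icc]
    exact integrableOn_const (by simp)

/-- `u ∈ C_c^∞(ℝ²)`. -/
def IsTestFun₂ (u : ℝ × ℝ → ℂ) : Prop := ContDiff ℝ ∞ u ∧ HasCompactSupport u

namespace IsTestFun₂

variable {u : ℝ × ℝ → ℂ}

theorem of_support_subset (hu : IsTestFun₂ u) {v : ℝ × ℝ → ℂ} (hv : ContDiff ℝ ∞ v)
    (h : Function.support v ⊆ tsupport u) : IsTestFun₂ v :=
  ⟨hv, hu.2.mono' h⟩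

theorem mul_left (hu : IsTestFun₂ u) {c : ℝ × ℝ → ℂ} (hc : ContDiff ℝ ∞ c) :
    IsTestFun₂ fun z => c z * u z :=
  ⟨hc.mul hu.1, hu.2.mul_left⟩

theorem add (hu : IsTestFun₂ u) {v : ℝ × ℝ → ℂ} (hv : IsTestFun₂ v) :
    IsTestFun₂ fun z => u z + v z :=
  ⟨hu.1.add hv.1, hu.2.add hv.2⟩

theorem differentiable (hu : IsTestFun₂ u) : Differentiable ℝ u :=
  hu.1.differentiable (by simp)

theorem hasDerivAt_fst (hu : IsTestFun₂ u) (x q : ℝ) :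
    HasDerivAt (fun x => u (x, q)) (fderiv ℝ u (x, q) (1, 0)) x :=
  (hu.differentiable (x, q)).hasFDerivAt.comp_hasDerivAt x
    ((hasDerivAt_id' x).prodMk (hasDerivAt_const x q))

theorem hasDerivAt_snd (hu : IsTestFun₂ u) (x q : ℝ) :
    HasDerivAt (fun q => u (x, q)) (fderiv ℝ u (x, q) (0, 1)) q :=
  (hu.differentiable (x, q)).hasFDerivAt.comp_hasDerivAt q
    ((hasDerivAt_const q x).prodMk (hasDerivAt_id' q))

theorem pderiv2_zero (hu : IsTestFun₂ u) : pderiv2 0 u = fun z => fderiv ℝ u z (1, 0) := by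
  funext z
  simp only [pderiv2, if_true]
  exact (hu.hasDerivAt_fst z.1 z.2).deriv

theorem pderiv2_one (hu : IsTestFun₂ u) : pderiv2 1 u = fun z => fderiv ℝ u z (0, 1) := by
  funext z
  simp only [pderiv2, one_ne_zero, if_false]
  exact (hu.hasDerivAt_snd z.1 z.2).deriv

theorem fderiv_apply (hu : IsTestFun₂ u) (e : ℝ × ℝ) : IsTestFun₂ fun z => fderiv ℝ u z e := by
  refine hu.of_support_subset ((hu.1.fderiv_right (by simp)).clm_apply contDiff_const) ?_
  intro z hz
  by_contra h
  refine hz ?_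
  have h1 : fderiv ℝ u z = 0 := by
    by_contra h'
    exact h (support_fderiv_subset ℝ h')
  change fderiv ℝ u z e = 0
  rw [h1]
  rfl

theorem pderiv2 (hu : IsTestFun₂ u) (i : Fin 2) : IsTestFun₂ (pderiv2 i u) := by
  fin_cases i
  · change IsTestFun₂ (_root_.pderiv2 0 u)
    rw [hu.pderiv2_zero]
    exact hu.fderiv_apply _
  · change IsTestFun₂ (_root_.pderiv2 1 u)
    rw [hu.pderiv2_one]
    exact hu.fderiv_apply _

theorem exists_bound (hu : IsTestFun₂ u) : ∃ R, ∀ x q, R < |x| → u (x, q) = 0 := by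
  obtain ⟨R, hR⟩ := hu.2.isBounded.subset_closedBall 0
  refine ⟨R, fun x q hx => image_eq_zero_of_notMem_tsupport fun h => ?_⟩
  have h1 := hR h
  rw [mem_closedBall_zero_iff, Prod.norm_def] at h1
  exact absurd ((le_max_left _ _).trans h1) (not_le.mpr hx)

theorem continuous_slice (hu : IsTestFun₂ u) (q : ℝ) : Continuous fun x => u (x, q) :=
  hu.1.continuous.comp (Continuous.prodMk_left q)

theorem hasCompactSupport_slice (hu : IsTestFun₂ u) (q : ℝ) :
    HasCompactSupport fun x => u (x, q) := by
  obtain ⟨R, hR⟩ := hu.exists_bound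
  refine HasCompactSupport.intro (isCompact_Icc (a := -R) (b := R)) fun x hx => hR x q ?_
  by_contra h
  exact hx (abs_le.mp (not_lt.mp h))

theorem integrable_mul_slice (hu : IsTestFun₂ u) (q : ℝ) {c : ℝ → ℂ} (hc : Continuous c) :
    Integrable fun x => c x * u (x, q) :=
  (hc.mul (hu.continuous_slice q)).integrable_of_hasCompactSupport
    (hu.hasCompactSupport_slice q).mul_left

end IsTestFun₂

theorem hasDerivAt_cexp_mul (x p : ℝ) :
    HasDerivAt (fun p : ℝ => Complex.exp (Complex.I * p * x))
      (Complex.exp (Complex.I * p * x) * (Complex.I * x)) p := by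
  have h := (((hasDerivAt_id' p).ofReal_comp.const_mul Complex.I).mul_const (x : ℂ)).cexp
  simpa using h

/-- The partial Fourier transform turns `∂_p` into multiplication by `ix`. -/
theorem pderiv2_zero_partialFourierInv {u : ℝ × ℝ → ℂ} (hu : IsTestFun₂ u) :
    pderiv2 0 (partialFourierInv u) = partialFourierInv fun z => Complex.I * z.1 * u z := by
  funext z
  obtain ⟨R, hR⟩ := hu.exists_bound
  have hc := hu.1.continuous
  have h := hasDerivAt_integral_of_bounded_support
    (g := fun p x => Complex.exp (Complex.I * p * x) * u (x, z.2))
    (g' := fun p x => Complex.exp (Complex.I * p * x) * (Complex.I * x * u (x, z.2)))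
    (by simp only [Function.uncurry_def]; fun_prop) (by simp only [Function.uncurry_def]; fun_prop)
    (fun τ x hx => by rw [hR _ _ hx, mul_zero])
    (fun τ x hx => by rw [hR _ _ hx, mul_zero, mul_zero])
    (fun p x => ((hasDerivAt_cexp_mul x p).mul_const (u (x, z.2))).congr_deriv (by ring)) z.1
  simp only [pderiv2, if_true, partialFourierInv]
  exact (h.const_mul _).deriv

theorem pderiv2_one_partialFourierInv {u : ℝ × ℝ → ℂ} (hu : IsTestFun₂ u) :
    pderiv2 1 (partialFourierInv u) = partialFourierInv (pderiv2 1 u) := by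
  funext z
  obtain ⟨R, hR⟩ := hu.exists_bound
  obtain ⟨R', hR'⟩ := (hu.fderiv_apply (0, 1)).exists_bound
  have hc := hu.1.continuous
  have hc' := (hu.fderiv_apply (0, 1)).1.continuous
  have h := hasDerivAt_integral_of_bounded_support (R := max R R')
    (g := fun q x => Complex.exp (Complex.I * z.1 * x) * u (x, q))
    (g' := fun q x => Complex.exp (Complex.I * z.1 * x) * fderiv ℝ u (x, q) (0, 1))
    (by simp only [Function.uncurry_def]; fun_prop)
    (by
      have h1 : Continuous fun y : ℝ × ℝ => fderiv ℝ u (y.2, y.1) (0, 1) :=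
        hc'.comp (continuous_snd.prodMk continuous_fst)
      simp only [Function.uncurry_def]
      fun_prop)
    (fun τ x hx => by rw [hR _ _ ((le_max_left _ _).trans_lt hx), mul_zero])
    (fun τ x hx => by rw [hR' _ _ ((le_max_right _ _).trans_lt hx), mul_zero])
    (fun q x => (hu.hasDerivAt_snd x q).const_mul _) z.2
  rw [hu.pderiv2_one]
  simp only [pderiv2, one_ne_zero, if_false, partialFourierInv]
  exact (h.const_mul _).deriv

/-- The partial Fourier transform turns `∂_x` into multiplication by `-ip`. -/
theorem partialFourierInv_pderiv2_zero {u : ℝ × ℝ → ℂ} (hu : IsTestFun₂ u) (z : ℝ × ℝ) :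
    partialFourierInv (pderiv2 0 u) z = -(Complex.I * z.1) * partialFourierInv u z := by
  have he : Continuous fun x : ℝ => Complex.exp (Complex.I * z.1 * x) := by fun_prop
  have hexp : ∀ x : ℝ, HasDerivAt (fun x : ℝ => Complex.exp (Complex.I * z.1 * x))
      (Complex.I * z.1 * Complex.exp (Complex.I * z.1 * x)) x := by
    intro x
    have h := ((hasDerivAt_id' x).ofReal_comp.const_mul (Complex.I * z.1)).cexp
    simpa [mul_comm] using h
  have h := integral_mul_deriv_eq_deriv_mul_of_integrable (fun x _ => hexp x)
    (fun x _ => hu.hasDerivAt_fst x z.2)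
    ((hu.fderiv_apply (1, 0)).integrable_mul_slice z.2 he)
    (hu.integrable_mul_slice z.2 (continuous_const.mul he)) (hu.integrable_mul_slice z.2 he)
  rw [hu.pderiv2_zero, partialFourierInv, partialFourierInv, h]
  simp only [mul_assoc (Complex.I * (z.1 : ℂ)), integral_const_mul]
  ring

theorem mderiv_zero_partialFourierInv {u : ℝ × ℝ → ℂ} (hu : IsTestFun₂ u) (r : ℕ) :
    mderiv (fun _ : Fin r => 0) (partialFourierInv u) =
      partialFourierInv fun z => (Complex.I * z.1) ^ r * u z := by
  induction r with
  | zero => simp [mderiv_zero]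
  | succ r ih =>
    have hc : ContDiff ℝ ∞ fun z : ℝ × ℝ => (Complex.I * z.1 : ℂ) ^ r :=
      (contDiff_const.mul (Complex.ofRealCLM.contDiff.comp contDiff_fst)).pow r
    rw [mderiv_succ, ih, pderiv2_zero_partialFourierInv (hu.mul_left hc)]
    simp only [pow_succ', mul_assoc]

theorem partialFourierInv_add {u v : ℝ × ℝ → ℂ} (hu : IsTestFun₂ u) (hv : IsTestFun₂ v)
    (z : ℝ × ℝ) : partialFourierInv (fun z => u z + v z) z =
      partialFourierInv u z + partialFourierInv v z := by
  have he : Continuous fun x : ℝ => Complex.exp (Complex.I * z.1 * x) := by fun_prop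
  simp only [partialFourierInv, mul_add]
  rw [integral_add (hu.integrable_mul_slice z.2 he) (hv.integrable_mul_slice z.2 he), mul_add]

theorem partialFourierInv_const_mul (c : ℂ) (u : ℝ × ℝ → ℂ) (z : ℝ × ℝ) :
    partialFourierInv (fun z => c * u z) z = c * partialFourierInv u z := by
  simp only [partialFourierInv, mul_left_comm _ c, integral_const_mul]

/-- Fourier inversion, rescaled from the kernel `e^{-2πixξ}`. -/
theorem integrable_and_partialFourier_partialFourierInv {w : ℝ × ℝ → ℂ} (hw : IsTestFun₂ w) :
    (∀ q : ℝ, Integrable fun p : ℝ => partialFourierInv w (p, q)) ∧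
      partialFourier (partialFourierInv w) = w := by
  have hsm : ∀ q : ℝ, ContDiff ℝ ∞ fun x => w (x, q) := fun q =>
    hw.1.comp (contDiff_id.prodMk contDiff_const)
  let γ : ℝ → SchwartzMap ℝ ℂ := fun q => (hw.hasCompactSupport_slice q).toSchwartzMap (hsm q)
  have hπ : (2 * Real.pi) ≠ 0 := by positivity
  have hinv : ∀ p q : ℝ, partialFourierInv w (p, q) =
      (1 / (Real.sqrt (2 * Real.pi) : ℂ)) *
        FourierTransformInv.fourierInv (γ q) (p / (2 * Real.pi)) := by
    intro p q
    rw [SchwartzMap.fourierInv_coe, Real.fourierInv_eq', partialFourierInv]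
    congr 1
    refine integral_congr_ae (ae_of_all _ fun x => ?_)
    have h1 : (γ q) x = w (x, q) := rfl
    have h2 : 2 * Real.pi * inner ℝ x (p / (2 * Real.pi)) = p * x := by
      rw [real_inner_eq_re_inner, RCLike.inner_apply]
      simp
      field_simp
    simp only [h1, h2, smul_eq_mul]
    congr 2
    push_cast
    ring
  have hint : ∀ q : ℝ, Integrable fun p : ℝ => partialFourierInv w (p, q) := by
    intro q
    simp only [hinv]
    exact ((FourierTransformInv.fourierInv (γ q)).integrable.comp_div hπ).const_mul _
  refine ⟨hint, ?_⟩
  funext z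
  obtain ⟨x, q⟩ := z
  obtain ⟨k, hk⟩ : ∃ k : ℝ → ℂ, k = fun ξ => (1 / (Real.sqrt (2 * Real.pi) : ℂ)) *
      (Complex.exp (((-2 * Real.pi * inner ℝ ξ x : ℝ) : ℂ) * Complex.I) •
        FourierTransformInv.fourierInv (γ q) ξ) := ⟨_, rfl⟩
  have h1 : ∀ p : ℝ, Complex.exp (-Complex.I * p * x) * partialFourierInv w (p, q) =
      k (p / (2 * Real.pi)) := by
    intro p
    have h2 : -2 * Real.pi * inner ℝ (p / (2 * Real.pi)) x = -(p * x) := by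
      rw [real_inner_eq_re_inner, RCLike.inner_apply]
      simp
      field_simp
    simp only [hinv, hk, h2, smul_eq_mul]
    rw [mul_left_comm]
    congr 3
    push_cast
    ring
  rw [partialFourier, integral_congr_ae (ae_of_all _ h1), Measure.integral_comp_div, hk,
    integral_const_mul, ← Real.fourier_eq', ← SchwartzMap.fourier_coe,
    FourierTransform.fourier_fourierInv_eq]
  have h3 : (γ q) x = w (x, q) := rfl
  rw [h3, abs_of_pos (by positivity), Complex.real_smul]
  have h4 : (Real.sqrt (2 * Real.pi) : ℂ) * Real.sqrt (2 * Real.pi) = (2 * Real.pi : ℝ) := by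
    rw [← Complex.ofReal_mul, Real.mul_self_sqrt (by positivity)]
  have h5 : (Real.sqrt (2 * Real.pi) : ℂ) ≠ 0 := by
    rw [Complex.ofReal_ne_zero]
    positivity
  rw [← h4]
  field_simp

/-! ### The operator `ℓ̂_Z` -/

/-- The differential operator `-α ∂_x + (α/2) ∂_q + i β e^q e^{-x/2}`, which is `ℓ̂_Z` in the
coordinates `(x, q)`. -/
def ellXQ (Z : aff) (u : ℝ × ℝ → ℂ) (z : ℝ × ℝ) : ℂ :=
  -(Z.1 0 0 : ℂ) * pderiv2 0 u z + (Z.1 0 0 : ℂ) / 2 * pderiv2 1 u z +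
    iHamQ Z z * (Complex.exp (-(z.1 / 2)) * u z)

theorem partialFourierInv_snd_mul (c : ℝ → ℂ) (u : ℝ × ℝ → ℂ) (z : ℝ × ℝ) :
    partialFourierInv (fun z => c z.2 * u z) z = c z.2 * partialFourierInv u z := by
  simp only [partialFourierInv, mul_left_comm _ (c z.2), integral_const_mul]

theorem contDiff_cexp_neg_half : ContDiff ℝ ∞ fun z : ℝ × ℝ => Complex.exp (-((z.1 : ℂ) / 2)) :=
  ((Complex.ofRealCLM.contDiff.comp contDiff_fst).div_const 2).neg.cexp

theorem contDiff_iHamQ (Z : aff) : ContDiff ℝ ∞ (iHamQ Z) :=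
  contDiff_const.mul (Complex.ofRealCLM.contDiff.comp (Real.contDiff_exp.comp contDiff_snd))

theorem IsTestFun₂.ellXQ {u : ℝ × ℝ → ℂ} (hu : IsTestFun₂ u) (Z : aff) :
    IsTestFun₂ (ellXQ Z u) :=
  (((hu.pderiv2 0).mul_left contDiff_const).add ((hu.pderiv2 1).mul_left contDiff_const)).add
    ((hu.mul_left contDiff_cexp_neg_half).mul_left (contDiff_iHamQ Z))

theorem partialFourierInv_ellXQ (Z : aff) {u : ℝ × ℝ → ℂ} (hu : IsTestFun₂ u) (z : ℝ × ℝ) :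
    partialFourierInv (ellXQ Z u) z =
      iHamQ Z z * partialFourierInv (fun z => Complex.exp (-(z.1 / 2)) * u z) z +
        Complex.I * Z.1 0 0 * z.1 * partialFourierInv u z +
        (Z.1 0 0 : ℂ) / 2 * partialFourierInv (pderiv2 1 u) z := by
  have h0 := (hu.pderiv2 0).mul_left (contDiff_const (c := -(Z.1 0 0 : ℂ)))
  have h1 := (hu.pderiv2 1).mul_left (contDiff_const (c := (Z.1 0 0 : ℂ) / 2))
  have h2 := (hu.mul_left contDiff_cexp_neg_half).mul_left (contDiff_iHamQ Z)
  have e1 := partialFourierInv_add (h0.add h1) h2 z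
  have e2 := partialFourierInv_add h0 h1 z
  have e3 := partialFourierInv_snd_mul (fun q => Complex.I * Z.1 0 1 * Real.exp q)
    (fun z => Complex.exp (-(z.1 / 2)) * u z) z
  change partialFourierInv (fun z => iHamQ Z z * (Complex.exp (-(z.1 / 2)) * u z)) z =
    iHamQ Z z * _ at e3
  change partialFourierInv (ellXQ Z u) z = _ at e1
  rw [e1, e2, e3, partialFourierInv_const_mul, partialFourierInv_const_mul,
    partialFourierInv_pderiv2_zero hu]
  ring

/-- Under the partial Fourier transform `∂_p` is multiplication by `ix`, so the Taylor series in
`(i/2) ∂_p` sums to multiplication by `e^{-x/2}`. -/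
theorem hasSum_partialFourierInv {u : ℝ × ℝ → ℂ} (hu : IsTestFun₂ u) (z : ℝ × ℝ) :
    HasSum (fun r : ℕ => (1 / (r.factorial : ℂ)) * (1 / (2 * Complex.I)) ^ r * (-1) ^ r *
        partialFourierInv (fun z => (Complex.I * z.1) ^ r * u z) z)
      (partialFourierInv (fun z => Complex.exp (-(z.1 / 2)) * u z) z) := by
  have hI : 1 / (2 * Complex.I) * (-1) * Complex.I = -1 / 2 := by
    field_simp
  have hterm : ∀ (r : ℕ) (x : ℝ), (1 / (r.factorial : ℂ)) * (1 / (2 * Complex.I)) ^ r * (-1) ^ r *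
      (Complex.I * x) ^ r = (-(x / 2 : ℂ)) ^ r / r.factorial := by
    intro r x
    have : (-(x / 2 : ℂ)) = 1 / (2 * Complex.I) * (-1) * (Complex.I * x) := by
      rw [← mul_assoc, hI]
      ring
    rw [this, mul_pow _ (Complex.I * x), mul_pow _ (-1)]
    ring
  have hcont := hu.1.continuous
  have key : HasSum (fun r : ℕ => ∫ x : ℝ, Complex.exp (Complex.I * z.1 * x) *
        ((-(x / 2 : ℂ)) ^ r / r.factorial * u (x, z.2)))
      (∫ x : ℝ, Complex.exp (Complex.I * z.1 * x) * (Complex.exp (-(x / 2)) * u (x, z.2))) := by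
    have hreal : ∀ x : ℝ, HasSum (fun r : ℕ => |x / 2| ^ r / r.factorial * ‖u (x, z.2)‖)
        (Real.exp |x / 2| * ‖u (x, z.2)‖) := by
      intro x
      have := NormedSpace.exp_series_hasSum_exp' (𝕂 := ℝ) |x / 2|
      rw [← Real.exp_eq_exp_ℝ] at this
      refine (this.mul_right ‖u (x, z.2)‖).congr_fun fun r => ?_
      rw [smul_eq_mul]
      ring
    refine hasSum_integral_of_dominated_convergence
      (fun r x => |x / 2| ^ r / r.factorial * ‖u (x, z.2)‖)
      (fun r => Continuous.aestronglyMeasurable (by fun_prop)) (fun r => ae_of_all _ fun x => ?_)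
      (ae_of_all _ fun x => (hreal x).summable) ?_ (ae_of_all _ fun x => ?_)
    · have h1 : ‖Complex.exp (Complex.I * z.1 * x)‖ = 1 := norm_exp_I_mul _ _
      rw [norm_mul, norm_mul, h1, one_mul, norm_div, norm_pow, norm_neg, Complex.norm_natCast,
        norm_div, Complex.norm_real, Real.norm_eq_abs, abs_div]
      simp
    · simp only [fun x : ℝ => (hreal x).tsum_eq]
      refine Continuous.integrable_of_hasCompactSupport (by fun_prop) ?_
      exact (hu.hasCompactSupport_slice z.2).norm.mul_left
    · have := NormedSpace.exp_series_hasSum_exp' (𝕂 := ℂ) (-(x / 2 : ℂ))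
      rw [← Complex.exp_eq_exp_ℂ] at this
      refine ((this.mul_right (u (x, z.2))).mul_left _).congr_fun fun r => ?_
      rw [smul_eq_mul]
      ring
  refine (key.mul_left (1 / (Real.sqrt (2 * Real.pi) : ℂ))).congr_fun fun r => ?_
  rw [partialFourierInv, mul_left_comm, ← integral_const_mul]
  congr 1
  refine integral_congr_ae (ae_of_all _ fun x => ?_)
  simp only
  rw [← hterm]
  ring

theorem isMoyalProduct_partialFourierInv (Z : aff) {u : ℝ × ℝ → ℂ} (hu : IsTestFun₂ u) :
    IsMoyalProduct (iHam Z) (partialFourierInv u) (partialFourierInv (ellXQ Z u)) := by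
  intro z
  rw [partialFourierInv_ellXQ Z hu]
  have h0 := hasSum_ite_eq (0 : ℕ) (Complex.I * Z.1 0 0 * z.1 * partialFourierInv u z)
  have h1 := hasSum_ite_eq (1 : ℕ) ((Z.1 0 0 : ℂ) / 2 * partialFourierInv (pderiv2 1 u) z)
  refine ((((hasSum_partialFourierInv hu z).mul_left (iHamQ Z z)).add h0).add h1).congr_fun
    fun r => ?_
  rw [← mderiv_zero_partialFourierInv hu]
  rcases r with _ | _ | r
  · rw [bidiff_iHam_zero, mderiv_zero, iHam_apply, iHamQ]
    simp
    ring
  · rw [bidiff_iHam_one, mderiv_succ, mderiv_zero, pderiv2_one_partialFourierInv hu]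
    have hI : 1 / (2 * Complex.I) * Complex.I = 1 / 2 := by
      field_simp
    simp only [zero_add, Nat.factorial_one, Nat.cast_one, pow_one, if_true, one_ne_zero, if_false]
    linear_combination (-(Z.1 0 0 : ℂ) * partialFourierInv (pderiv2 1 u) z) * -hI
  · rw [bidiff_iHam_add_two]
    simp
    ring

theorem isEllHat_ellXQ (Z : aff) {u : ℝ × ℝ → ℂ} (hu : IsTestFun₂ u) :
    IsEllHat Z u (ellXQ Z u) :=
  ⟨_, isMoyalProduct_partialFourierInv Z hu,
    (integrable_and_partialFourier_partialFourierInv (hu.ellXQ Z)).1,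
    (integrable_and_partialFourier_partialFourierInv (hu.ellXQ Z)).2.symm⟩

theorem IsEllHat.unique {Z : aff} {u w₁ w₂ : ℝ × ℝ → ℂ} (h₁ : IsEllHat Z u w₁)
    (h₂ : IsEllHat Z u w₂) : w₁ = w₂ := by
  obtain ⟨v₁, hv₁, -, rfl⟩ := h₁
  obtain ⟨v₂, hv₂, -, rfl⟩ := h₂
  rw [funext fun z => (hv₁ z).unique (hv₂ z)]

/-! ### Reduction to the variable `y = e^s` -/

theorem isTestFun₂_liftST {f χ : ℝ → ℂ} (hf : IsHalfLineTestFun f) (hχ : IsTestFun χ) :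
    IsTestFun₂ (liftST f χ) := by
  have hs : ContDiff ℝ ∞ fun z : ℝ × ℝ => z.2 - z.1 / 2 :=
    contDiff_snd.sub (contDiff_fst.div_const 2)
  have ht : ContDiff ℝ ∞ fun z : ℝ × ℝ => z.2 + z.1 / 2 :=
    contDiff_snd.add (contDiff_fst.div_const 2)
  refine ⟨(hf.1.1.comp (Real.contDiff_exp.comp hs)).mul (hχ.1.comp ht), ?_⟩
  obtain ⟨a, b, ha, hab⟩ := hf.exists_support_subset_Icc
  have hcomp : IsCompact ((fun w : ℝ × ℝ => (w.2 - w.1, (w.1 + w.2) / 2)) ''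
      (Icc (Real.log a) (Real.log b) ×ˢ tsupport χ)) :=
    (isCompact_Icc.prod hχ.2).image (by fun_prop)
  refine HasCompactSupport.intro hcomp fun z hz => ?_
  by_contra h
  obtain ⟨h1, h2⟩ := mul_ne_zero_iff.mp h
  refine hz ⟨(z.2 - z.1 / 2, z.2 + z.1 / 2), ⟨?_, subset_tsupport χ h2⟩, ?_⟩
  · have h3 : Real.exp (z.2 - z.1 / 2) ∈ Icc a b := by
      by_contra h4
      exact h1 (hab _ h4)
    have h5 := Real.log_le_log ha h3.1
    have h6 := Real.log_le_log (Real.exp_pos _) h3.2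
    rw [Real.log_exp] at h5 h6
    exact ⟨h5, h6⟩
  · ext <;> simp only <;> ring

/-- `-α ∂_x + (α/2) ∂_q = α ∂_s`, and `e^q e^{-x/2} = e^s`. -/
theorem ellXQ_liftST (Z : aff) {f χ : ℝ → ℂ} (hf : Differentiable ℝ f)
    (hχ : Differentiable ℝ χ) : ellXQ Z (liftST f χ) = liftST (ellOp Z f) χ := by
  funext z
  obtain ⟨x, q⟩ := z
  have hx1 : HasDerivAt (fun x : ℝ => Real.exp (q - x / 2))
      (Real.exp (q - x / 2) * (-(1 / 2))) x :=
    (((hasDerivAt_id' x).div_const 2).const_sub q).exp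
  have hx2 : HasDerivAt (fun x : ℝ => q + x / 2) (1 / 2) x :=
    ((hasDerivAt_id' x).div_const 2).const_add q
  have hq1 : HasDerivAt (fun q : ℝ => Real.exp (q - x / 2)) (Real.exp (q - x / 2) * 1) q :=
    ((hasDerivAt_id' q).sub_const (x / 2)).exp
  have hq2 : HasDerivAt (fun q : ℝ => q + x / 2) 1 q := (hasDerivAt_id' q).add_const (x / 2)
  have h0 : pderiv2 0 (liftST f χ) (x, q) = _ :=
    (((hf (Real.exp (q - x / 2))).hasDerivAt.scomp x hx1).mul
      ((hχ (q + x / 2)).hasDerivAt.scomp x hx2)).deriv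
  have h1 : pderiv2 1 (liftST f χ) (x, q) = _ :=
    (((hf (Real.exp (q - x / 2))).hasDerivAt.scomp q hq1).mul
      ((hχ (q + x / 2)).hasDerivAt.scomp q hq2)).deriv
  have he : (Real.exp q : ℂ) * Complex.exp (-(x / 2)) = (Real.exp (q - x / 2) : ℂ) := by
    rw [Complex.ofReal_exp, Complex.ofReal_exp, ← Complex.exp_add]
    congr 1
    push_cast
    ring
  simp only [ellXQ, h0, h1, liftST, ellOp, iHamQ, Function.comp_apply, Complex.real_smul]
  rw [← mul_assoc _ (Complex.exp _), mul_assoc _ (Real.exp q : ℂ), he]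
  push_cast
  ring

theorem isEllHatHalfLine_ellOp (Z : aff) {f : ℝ → ℂ} (hf : IsHalfLineTestFun f) :
    IsEllHatHalfLine Z f (ellOp Z f) := by
  intro χ hχ
  have h := isEllHat_ellXQ Z (isTestFun₂_liftST hf hχ)
  rwa [ellXQ_liftST Z hf.differentiable (hχ.1.differentiable (by simp))] at h

theorem exists_isTestFun_apply_zero : ∃ χ : ℝ → ℂ, IsTestFun χ ∧ χ 0 = 1 := by
  let b : ContDiffBump (0 : ℝ) := ⟨1, 2, one_pos, one_lt_two⟩
  refine ⟨fun x => (b x : ℂ), ⟨Complex.ofRealCLM.contDiff.comp b.contDiff,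
    b.hasCompactSupport.comp_left (g := Complex.ofReal) rfl⟩, ?_⟩
  change (b 0 : ℂ) = 1
  rw [b.one_of_mem_closedBall (Metric.mem_closedBall_self zero_le_one), Complex.ofReal_one]

theorem IsHalfLineTestFun.eq_zero_of_nonpos {f : ℝ → ℂ} (hf : IsHalfLineTestFun f) {y : ℝ}
    (hy : y ≤ 0) : f y = 0 :=
  image_eq_zero_of_notMem_tsupport fun h => not_lt.mpr hy (hf.2 h)

theorem IsEllHatHalfLine.eq_ellOp {Z : aff} {f h : ℝ → ℂ} (hf : IsHalfLineTestFun f)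
    (hh : IsHalfLineTestFun h) (H : IsEllHatHalfLine Z f h) : h = ellOp Z f := by
  obtain ⟨χ, hχ, hχ0⟩ := exists_isTestFun_apply_zero
  have h1 := (H χ hχ).unique (isEllHatHalfLine_ellOp Z hf χ hχ)
  funext y
  rcases le_or_gt y 0 with hy | hy
  · rw [hh.eq_zero_of_nonpos hy, (hf.ellOp Z).eq_zero_of_nonpos hy]
  · -- the point with `t = 0` and `s = log y`
    have h2 := congrFun h1 (-Real.log y, Real.log y / 2)
    have hs : Real.log y / 2 - -Real.log y / 2 = Real.log y := by ring
    have ht : Real.log y / 2 + -Real.log y / 2 = 0 := by ring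
    simpa only [liftST, hs, ht, Real.exp_log hy, hχ0, mul_one] using h2

theorem ellHatGraph_eq (Z : aff) :
    ellHatGraph Z = (ellGraph Z : Set (L2HalfLine × L2HalfLine)) := by
  ext ⟨φ, ψ⟩
  constructor
  · rintro ⟨f, h, hf, hh, H, hφ, hψ⟩
    obtain rfl := H.eq_ellOp hf hh
    refine ⟨f, hf, Prod.ext ?_ ?_⟩
    · exact Lp.ext (hφ.trans hf.memLp.coeFn_toLp.symm)
    · exact Lp.ext (hψ.trans hh.memLp.coeFn_toLp.symm)
  · rintro ⟨f, hf, hw⟩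
    rw [hw]
    exact ⟨f, ellOp Z f, hf, hf.ellOp Z, isEllHatHalfLine_ellOp Z hf, hf.memLp.coeFn_toLp,
      (hf.ellOp Z).memLp.coeFn_toLp⟩

/-! ### Irreducibility -/

/-- Injectivity of the Fourier transform on `L¹(μ)`. -/
theorem ae_eq_zero_of_integral_cexp_mul_eq_zero {μ : Measure ℝ} [SigmaFinite μ] {k : ℝ → ℂ}
    (hk : Integrable k μ)
    (h : ∀ b : ℝ, ∫ y, Complex.exp (Complex.I * b * y) * k y ∂μ = 0) : ∀ᵐ y ∂μ, k y = 0 := by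
  refine ae_eq_zero_of_integral_contDiff_smul_eq_zero hk.locallyIntegrable fun g hg hgc => ?_
  have hγ1 : HasCompactSupport fun x => (g x : ℂ) := hgc.comp_left (g := Complex.ofReal) rfl
  let γ : SchwartzMap ℝ ℂ := hγ1.toSchwartzMap (Complex.ofRealCLM.contDiff.comp hg)
  let δ : SchwartzMap ℝ ℂ := FourierTransformInv.fourierInv γ
  have hδ : ∀ x, VectorFourier.fourierIntegral Real.fourierChar volume (innerₗ ℝ) δ x = g x := by
    intro x
    have h1 : FourierTransform.fourier δ = γ := FourierTransform.fourier_fourierInv_eq γ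
    exact congrArg (fun u : SchwartzMap ℝ ℂ => u x) h1
  have hk0 : ∀ x, VectorFourier.fourierIntegral Real.fourierChar μ (innerₗ ℝ).flip k x = 0 := by
    intro x
    rw [← h (-(2 * Real.pi * x)), VectorFourier.fourierIntegral]
    refine integral_congr_ae (ae_of_all _ fun y => ?_)
    simp only [Circle.smul_def, Real.fourierChar_apply, smul_eq_mul, LinearMap.flip_apply,
      innerₗ_apply_apply]
    congr 2
    rw [real_inner_eq_re_inner, RCLike.inner_apply]
    simp
    ring
  have hflip := VectorFourier.integral_fourierIntegral_smul_eq_flip (L := innerₗ ℝ)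
    (μ := volume) (ν := μ) Real.continuous_fourierChar continuous_inner δ.integrable hk
  simp only [hδ, hk0, smul_zero, integral_zero] at hflip
  rw [← hflip]
  simp only [Complex.real_smul, smul_eq_mul]

/-- A matrix coefficient `⟪ψ, T(a, b) φ⟫` is the Fourier transform of `y ↦ φ(ay) conj(ψ y)` in the
variable `b`. -/
theorem ae_mul_eq_zero_of_inner_eq_zero {φ ψ : L2HalfLine}
    (h : ∀ g, inner ℂ ψ ((affRep g : L2HalfLine →L[ℂ] L2HalfLine) φ) = 0) {a : ℝ} (ha : 0 < a) :
    ∀ᵐ y ∂halfLineMeasure, φ (a * y) = 0 ∨ ψ y = 0 := by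
  have hT : ∀ b : ℝ, (fun y => Complex.exp (Complex.I * b * y) *
      (φ (a * y) * starRingEnd ℂ (ψ y))) =ᵐ[halfLineMeasure]
      fun y => inner ℂ (ψ y) ((affRep (Aff0.mk a b ha) : L2HalfLine →L[ℂ] L2HalfLine) φ y) := by
    intro b
    filter_upwards [affRep_coeFn (Aff0.mk a b ha) φ] with y hy
    rw [hy, RCLike.inner_apply, affAct, affA_mk, affB_mk, ← mul_assoc]
  have hint : Integrable (fun y => φ (a * y) * starRingEnd ℂ (ψ y)) halfLineMeasure := by
    refine (integrable_congr ?_).mp (L2.integrable_inner ψ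
      ((affRep (Aff0.mk a 0 ha) : L2HalfLine →L[ℂ] L2HalfLine) φ))
    filter_upwards [hT 0] with y hy
    rw [← hy]
    simp
  have h0 := ae_eq_zero_of_integral_cexp_mul_eq_zero hint fun b => by
    rw [integral_congr_ae (hT b), ← L2.inner_def, h]
  filter_upwards [h0] with y hy
  simpa using hy

/-- `∫∫ |φ(ay)| |ψ(y)| dy/y da/a = ∫ |φ| · ∫ |ψ|` by invariance of `dy/y`. -/
theorem eq_zero_or_eq_zero_of_inner_eq_zero {φ ψ : L2HalfLine}
    (h : ∀ g, inner ℂ ψ ((affRep g : L2HalfLine →L[ℂ] L2HalfLine) φ) = 0) : φ = 0 ∨ ψ = 0 := by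
  have hφ : Measurable fun y => ‖φ y‖ₑ := (Lp.stronglyMeasurable φ).enorm
  have hψ : Measurable fun y => ‖ψ y‖ₑ := (Lp.stronglyMeasurable ψ).enorm
  have h1 : ∫⁻ a, ∫⁻ y, ‖φ (a * y)‖ₑ * ‖ψ y‖ₑ ∂halfLineMeasure ∂halfLineMeasure = 0 := by
    rw [lintegral_congr_ae (g := fun _ => 0), lintegral_zero]
    filter_upwards [ae_pos_halfLineMeasure] with a ha
    rw [lintegral_congr_ae (g := fun _ => 0), lintegral_zero]
    filter_upwards [ae_mul_eq_zero_of_inner_eq_zero h ha] with y hy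
    rcases hy with hy | hy <;> simp [hy]
  rw [lintegral_lintegral_swap (((hφ.comp (measurable_fst.mul measurable_snd)).mul
    (hψ.comp measurable_snd)).aemeasurable)] at h1
  have h2 : ∫⁻ y, ∫⁻ a, ‖φ (a * y)‖ₑ * ‖ψ y‖ₑ ∂halfLineMeasure ∂halfLineMeasure =
      (∫⁻ a, ‖φ a‖ₑ ∂halfLineMeasure) * ∫⁻ y, ‖ψ y‖ₑ ∂halfLineMeasure := by
    rw [← lintegral_const_mul _ hψ]
    refine lintegral_congr_ae ?_
    filter_upwards [ae_pos_halfLineMeasure] with y hy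
    have hφy : Measurable fun a => ‖φ (a * y)‖ₑ := hφ.comp (measurable_mul_const y)
    rw [lintegral_mul_const _ hφy]
    simp only [mul_comm _ y]
    rw [(measurePreserving_mul_left hy).lintegral_comp hφ]
  rw [h2, mul_eq_zero, lintegral_eq_zero_iff hφ, lintegral_eq_zero_iff hψ] at h1
  refine h1.imp (fun h => ?_) fun h => ?_ <;>
  · rw [Lp.eq_zero_iff_ae_eq_zero]
    filter_upwards [h] with y hy
    simpa using hy

theorem isIrreducibleRep_affRep : IsIrreducibleRep affRep := by
  refine ⟨inferInstance, fun V hV hinv => ?_⟩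
  by_contra! hne
  obtain ⟨φ, hφV, hφ⟩ := V.ne_bot_iff.mp hne.1
  have hperp : Vᗮ ≠ ⊥ := by
    rw [Ne, ← Submodule.topologicalClosure_eq_top_iff, hV.submodule_topologicalClosure_eq]
    exact hne.2
  obtain ⟨ψ, hψV, hψ⟩ := Vᗮ.ne_bot_iff.mp hperp
  have h : ∀ g, inner ℂ ψ ((affRep g : L2HalfLine →L[ℂ] L2HalfLine) φ) = 0 := fun g =>
    (Submodule.mem_orthogonal' V ψ).mp hψV _ (hinv g φ hφV)
  exact (eq_zero_or_eq_zero_of_inner_eq_zero h).elim hφ hψ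

/-! ### The induced representations -/

instance : BorelSpace Aff0 := ⟨rfl⟩

section Induced

variable {H : Subgroup Aff0}

/-- The coordinate `a` on `H \ G`, for `H = {a = 1}`. -/
def cosetA (hH : ∀ g, g ∈ H ↔ affA g = 1) : RightCosets H → ℝ :=
  Quotient.lift affA fun x y h => by
    have h1 := (hH _).mp (QuotientGroup.rightRel_apply.mp h)
    rw [affA_mul, affA_inv, mul_inv_eq_one₀ (affA_pos x).ne'] at h1
    exact h1.symm

theorem cosetA_mk (hH : ∀ g, g ∈ H ↔ affA g = 1) (g : Aff0) :
    cosetA hH (Quotient.mk _ g) = affA g := rfl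

theorem cosetA_pos (hH : ∀ g, g ∈ H ↔ affA g = 1) (x : RightCosets H) : 0 < cosetA hH x := by
  induction x using Quotient.inductionOn with
  | h g => exact affA_pos g

theorem cosetA_cosetMul (hH : ∀ g, g ∈ H ↔ affA g = 1) (g : Aff0) (x : RightCosets H) :
    cosetA hH (cosetMul H g x) = cosetA hH x * affA g := by
  induction x using Quotient.inductionOn with
  | h k => exact affA_mul k g

theorem cosetA_injective (hH : ∀ g, g ∈ H ↔ affA g = 1) : Function.Injective (cosetA hH) := by
  intro x y h
  induction x using Quotient.inductionOn with
  | h g =>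
    induction y using Quotient.inductionOn with
    | h k =>
      refine Quotient.sound (QuotientGroup.rightRel_apply.mpr ((hH _).mpr ?_))
      have h' : affA g = affA k := h
      rw [affA_mul, affA_inv, h', mul_inv_cancel₀ (affA_pos k).ne']

/-- The section `x ↦ !![a, 0; 0, 1]` of `G → H \ G`. -/
def cosetSection (hH : ∀ g, g ∈ H ↔ affA g = 1) (x : RightCosets H) : Aff0 :=
  Aff0.mk (cosetA hH x) 0 (cosetA_pos hH x)

theorem measurable_cosetA (hH : ∀ g, g ∈ H ↔ affA g = 1) : Measurable (cosetA hH) :=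
  measurable_from_quotient.mpr continuous_affA.measurable

theorem measurable_cosetSection (hH : ∀ g, g ∈ H ↔ affA g = 1) : Measurable (cosetSection hH) := by
  refine measurable_from_quotient.mpr (Continuous.measurable ?_)
  change Continuous fun g => Aff0.mk (affA g) 0 (affA_pos g)
  have h : (fun g => Aff0.mk (affA g) 0 (affA_pos g)) =
      (fun t : ℝ => Aff0.mk (Real.exp t) 0 (Real.exp_pos t)) ∘ fun g => Real.log (affA g) := by
    funext g
    apply Aff0.ext_entries
    · exact (Real.exp_log (affA_pos g)).symm
    · rfl
  rw [h]
  exact (continuous_aff0_mk Real.continuous_exp continuous_const Real.exp_pos).comp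
    (continuous_affA.log fun g => (affA_pos g).ne')

theorem mk_cosetSection (hH : ∀ g, g ∈ H ↔ affA g = 1) (x : RightCosets H) :
    (Quotient.mk _ (cosetSection hH x) : RightCosets H) = x :=
  cosetA_injective hH (by rw [cosetA_mk, cosetSection, affA_mk])

/-- The coset with coordinate `a = y / c`, for `y > 0`. Writing `a` as `exp (log (y / c))` makes it
positive, so that the coset is defined, for every real `y`. -/
def cosetOf (H : Subgroup Aff0) (c y : ℝ) : RightCosets H :=
  Quotient.mk _ (Aff0.mk (Real.exp (Real.log (y / c))) 0 (Real.exp_pos _))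

theorem cosetA_cosetOf (hH : ∀ g, g ∈ H ↔ affA g = 1) {c y : ℝ} (hc : 0 < c) (hy : 0 < y) :
    cosetA hH (cosetOf H c y) = y / c :=
  Real.exp_log (div_pos hy hc)

theorem measurable_cosetOf (c : ℝ) : Measurable (cosetOf H c) := by
  have h1 : Measurable fun t : ℝ => (Quotient.mk _ (Aff0.mk (Real.exp t) 0 (Real.exp_pos t)) :
      RightCosets H) :=
    measurable_quotient_mk''.comp
      (continuous_aff0_mk Real.continuous_exp continuous_const Real.exp_pos).measurable
  exact h1.comp (Real.measurable_log.comp (measurable_id.div_const c))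

/-- The `G`-invariant measure on `H \ G ≅ ℝ_{>0}`. -/
def cosetMeasure (H : Subgroup Aff0) (c : ℝ) : Measure (RightCosets H) :=
  halfLineMeasure.map (cosetOf H c)

theorem measurePreserving_cosetOf (c : ℝ) :
    MeasurePreserving (cosetOf H c) halfLineMeasure (cosetMeasure H c) :=
  ⟨measurable_cosetOf c, rfl⟩

theorem measurePreserving_mul_cosetA (hH : ∀ g, g ∈ H ↔ affA g = 1) {c : ℝ} (hc : 0 < c) :
    MeasurePreserving (fun x => c * cosetA hH x) (cosetMeasure H c) halfLineMeasure := by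
  have hm : Measurable fun x => c * cosetA hH x := (measurable_cosetA hH).const_mul c
  refine ⟨hm, ?_⟩
  rw [cosetMeasure, Measure.map_map hm (measurable_cosetOf c)]
  have h : (fun x => c * cosetA hH x) ∘ cosetOf H c =ᵐ[halfLineMeasure] id := by
    filter_upwards [ae_pos_halfLineMeasure] with y hy
    rw [Function.comp_apply, cosetA_cosetOf hH hc hy, mul_div_cancel₀ _ hc.ne', id]
  rw [Measure.map_congr h, Measure.map_id]

theorem sigmaFinite_cosetMeasure (hH : ∀ g, g ∈ H ↔ affA g = 1) {c : ℝ} (hc : 0 < c) :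
    SigmaFinite (cosetMeasure H c) := by
  have h := measurePreserving_mul_cosetA hH hc
  refine SigmaFinite.of_map _ h.measurable.aemeasurable ?_
  rw [h.map_eq]
  infer_instance

theorem measurable_cosetMul (H : Subgroup Aff0) (g : Aff0) : Measurable (cosetMul H g) := by
  refine measurable_from_quotient.mpr (measurable_quotient_mk''.comp ?_)
  exact (continuous_mul_const g).measurable

theorem map_cosetMul_cosetMeasure (hH : ∀ g, g ∈ H ↔ affA g = 1) {c : ℝ} (hc : 0 < c) (g : Aff0) :
    (cosetMeasure H c).map (cosetMul H g) = cosetMeasure H c := by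
  rw [cosetMeasure, Measure.map_map (measurable_cosetMul H g) (measurable_cosetOf c)]
  conv_rhs => rw [← (measurePreserving_mul_left (affA_pos g)).map_eq,
    Measure.map_map (measurable_cosetOf c) (measurable_const_mul _)]
  refine Measure.map_congr ?_
  filter_upwards [ae_pos_halfLineMeasure] with y hy
  apply cosetA_injective hH
  rw [Function.comp_apply, Function.comp_apply, cosetA_cosetMul, cosetA_cosetOf hH hc hy,
    cosetA_cosetOf hH hc (mul_pos (affA_pos g) hy)]
  ring

/-- The isometry `f ↦ (x ↦ f(c a(x)))` from `L²(dy/y)` onto `L²(H \ G)`. -/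
def cosetIsometry (hH : ∀ g, g ∈ H ↔ affA g = 1) {c : ℝ} (hc : 0 < c) :
    L2HalfLine ≃ₗᵢ[ℂ] Lp ℂ 2 (cosetMeasure H c) :=
  LinearIsometryEquiv.ofSurjective
    (Lp.compMeasurePreservingₗᵢ ℂ _ (measurePreserving_mul_cosetA hH hc)) (by
      intro ψ
      refine ⟨Lp.compMeasurePreserving _ (measurePreserving_cosetOf c) ψ, ?_⟩
      apply Lp.ext
      have h1 := Lp.coeFn_compMeasurePreserving
        (Lp.compMeasurePreserving _ (measurePreserving_cosetOf c) ψ)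
        (measurePreserving_mul_cosetA hH hc)
      have h2 := (measurePreserving_mul_cosetA hH hc).quasiMeasurePreserving.ae_eq_comp
        (Lp.coeFn_compMeasurePreserving ψ (measurePreserving_cosetOf (H := H) c))
      refine h1.trans (h2.trans (ae_of_all _ fun x => ?_))
      have h3 : cosetOf H c (c * cosetA hH x) = x := cosetA_injective hH (by
        rw [cosetA_cosetOf hH hc (mul_pos hc (cosetA_pos hH x)), mul_div_cancel_left₀ _ hc.ne'])
      simp only [Function.comp_apply, h3])

theorem cosetIsometry_coeFn (hH : ∀ g, g ∈ H ↔ affA g = 1) {c : ℝ} (hc : 0 < c) (φ : L2HalfLine) :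
    cosetIsometry hH hc φ =ᵐ[cosetMeasure H c] fun x => φ (c * cosetA hH x) :=
  Lp.coeFn_compMeasurePreserving φ (measurePreserving_mul_cosetA hH hc)

/-- In the coordinate `a` of `H \ G`, the representation induced by `χ(1, b) = e^{icb}` is
`φ ↦ (x ↦ e^{i c b x} φ(x a))`; the substitution `y = c x` turns it into `T`. -/
theorem isInducedRep_affRep (hH : ∀ g, g ∈ H ↔ affA g = 1) {c : ℝ} (hc : 0 < c) (χ : H →* Circle)
    (hχ : ∀ h : H, (χ h : ℂ) = Complex.exp (Complex.I * (c * affB h : ℝ))) :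
    IsInducedRep χ affRep := by
  have hσ := sigmaFinite_cosetMeasure hH hc
  refine ⟨cosetMeasure H c, cosetSection hH, cosetIsometry hH hc, hσ, ?_, ?_,
    measurable_cosetSection hH, mk_cosetSection hH, ?_⟩
  · intro h0
    have h1 := (measurePreserving_mul_cosetA hH hc).map_eq
    rw [h0, Measure.map_zero, ← measurePreserving_exp.map_eq, eq_comm,
      Measure.map_eq_zero_iff Real.measurable_exp.aemeasurable] at h1
    exact NeZero.ne (volume : Measure ℝ) h1
  · intro g
    rw [map_cosetMul_cosetMeasure hH hc]
  · intro g φ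
    have hmul : MeasurePreserving (cosetMul H g) (cosetMeasure H c) (cosetMeasure H c) :=
      ⟨measurable_cosetMul H g, map_cosetMul_cosetMeasure hH hc g⟩
    rw [map_cosetMul_cosetMeasure hH hc]
    filter_upwards [cosetIsometry_coeFn hH hc ((affRep g : L2HalfLine →L[ℂ] L2HalfLine) φ),
      (measurePreserving_mul_cosetA hH hc).quasiMeasurePreserving.ae_eq_comp (affRep_coeFn g φ),
      hmul.quasiMeasurePreserving.ae_eq_comp (cosetIsometry_coeFn hH hc φ),
      Measure.rnDeriv_self (cosetMeasure H c)] with x h1 h2 h3 h4 h hh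
    have hB := congrArg affB hh
    have hA : affA (h : Aff0) = 1 := (hH _).mp h.2
    rw [affB_mul, affB_mul, hA, cosetSection, cosetSection, affB_mk, affB_mk, affA_mk] at hB
    simp only [Function.comp_apply] at h2 h3
    rw [h1, h2, h3, h4, affAct, cosetA_cosetMul, hχ]
    have h5 : affB (h : Aff0) = cosetA hH x * affB g := by linarith
    rw [h5, ENNReal.toReal_one, Real.sqrt_one, Complex.ofReal_one, mul_one,
      show affA g * (c * cosetA hH x) = c * (cosetA hH x * affA g) by ring]
    congr 2
    push_cast
    ring

end Induced

/-- The character `(1, b) ↦ e^{icb}` of `H = {a = 1}`. -/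
def unipotentChar {H : Subgroup Aff0} (hH : ∀ g, g ∈ H ↔ affA g = 1) (c : ℝ) : H →* Circle where
  toFun h := Circle.exp (c * affB h)
  map_one' := by simp
  map_mul' h k := by
    have hA : affA (h : Aff0) = 1 := (hH _).mp h.2
    rw [← Circle.exp_add]
    congr 1
    rw [Subgroup.coe_mul, affB_mul, hA]
    ring

theorem isOrbitMethodRep_affRep : IsOrbitMethodRep OmegaPlus affRep := by
  intro F hF
  refine ⟨exists_isAdmissible hF, fun 𝔥 h𝔥 => ?_⟩
  have hpos : 0 < F affY := by rw [omegaPlus_eq] at hF; exact hF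
  have hspan := (isAdmissible_iff hF 𝔥).mp h𝔥
  have hH := mem_analyticSubgroup hspan
  have hval : ∀ h, (unipotentChar hH (F affY) h : ℂ) =
      Complex.exp (Complex.I * (F affY * affB h : ℝ)) := by
    intro h
    rw [mul_comm]
    exact Circle.coe_exp _
  refine ⟨unipotentChar hH (F affY), ?_, isInducedRep_affRep hH hpos _ hval⟩
  intro A hA h hh
  have hA0 : A.1 0 0 = 0 := by
    rw [← mem_span_affY, ← hspan]
    exact hA
  have hB : affB (h : Aff0) = A.1 0 1 := by
    rw [hh, affB_affExp, hA0]
    simp [expQuot]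
  rw [hval, hB, dual_aff_apply F A, hA0]
  ring_nf

theorem theorem4p2 :
    OmegaPlus = {F : Module.Dual ℝ aff | 0 < F affY} ∧
    Function.Bijective affExp ∧
    (∀ (Z : aff) (f : ℝ → ℂ), IsHalfLineTestFun f →
      ∃! h : ℝ → ℂ, IsHalfLineTestFun h ∧ IsEllHatHalfLine Z f h) ∧
    ∃ T : Aff0 →* unitary (L2HalfLine →L[ℂ] L2HalfLine),
      (∀ φ : L2HalfLine, Continuous fun g => (T g : L2HalfLine →L[ℂ] L2HalfLine) φ) ∧
      (∀ (Z : aff) (U : ℝ → L2HalfLine →L[ℂ] L2HalfLine),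
        IsExpGroup (ellHatGraph Z) U ↔ ∀ t : ℝ, U t = T (affExp (t • Z))) ∧
      IsIrreducibleRep T ∧
      (∀ F ∈ OmegaPlus, ∀ 𝔥 : LieSubalgebra ℝ aff,
        IsAdmissible F 𝔥 ↔ 𝔥.toSubmodule = Submodule.span ℝ {affY}) ∧
      IsOrbitMethodRep OmegaPlus T ∧
      ∀ (g : Aff0) (φ : L2HalfLine),
        (T g : L2HalfLine →L[ℂ] L2HalfLine) φ =ᵐ[halfLineMeasure]
          fun y => Complex.exp (Complex.I * affB g * y) * φ (affA g * y) := by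
  refine ⟨omegaPlus_eq, affExp_bijective, fun Z f hf => ?_, affRep, continuous_affRep,
    fun Z U => ?_, isIrreducibleRep_affRep, fun F hF 𝔥 => isAdmissible_iff hF 𝔥,
    isOrbitMethodRep_affRep, affRep_coeFn⟩
  · exact ⟨ellOp Z f, ⟨hf.ellOp Z, isEllHatHalfLine_ellOp Z hf⟩,
      fun h hh => hh.2.eq_ellOp hf hh.1⟩
  · rw [ellHatGraph_eq]
    exact isExpGroup_ellGraph_iff Z U

end
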